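/- **Setting.** A (1-dimensional, 1st order, autonomous) control system $\dot x=F(x,u,\dot u)$ on a domain (nonempty connected open set) $D\subset\mathbb R^3$ with coordinates $(x,u,u_1)$ is given by a smooth function $F:D\to\mathbb R$. A local feedback transformation is a local diffeomorphism $\Phi:(x,u)\mapsto(X(x),U(x,u))$. It carries $F$ near $p$ to $G$ near $q$ if its prolongation $(x,u,u_1)\mapsto (X,\,U,\,U_xF+U_uu_1)$ maps $p$ to $q$ and $X_x\,F=G(X,U,U_xF+U_uu_1)$ near $p$. The systems $F$ on $D$ and $G$ on $D'$ are *locally feedback equivalent* if for every $p\in D$ there are $q\in D'$ and a local feedback transformation carrying $F$ near $p$ to $G$ near $q$, and for every $q\in D'$ there are $p\in D$ and such a transformation. On a system $f=F(x,u,u_1)$ put $$J=\frac{f^2f_{u_1u_1}}{(u_1f_{u_1}-f)f_{u_1}^2},$$ $$\nabla_1=\frac{u_1f_{u_1}-f}{f_{u_1}}\frac{\partial}{\partial u}+\frac{f-u_1f_{u_1}}{f_{u_1}^2}f_u\frac{\partial}{\partial u_1},\qquad \nabla_2=\frac{f}{f_{u_1}}\frac{\partial}{\partial u_1},$$ $$\nabla_3=f\frac{\partial}{\partial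 x}+\frac{f}{f_{u_1}}\frac{\partial}{\partial u}+\Big(\frac{f_xf_{u_1}+f_u-u_1f_{uu_1}-ff_{xu_1}}{f_{u_1u_1}}+\frac{u_1f_{u_1}-f}{f_{u_1}^2}f_u\Big)\frac{\partial}{\partial u_1},$$ and let $K$ be the function with $[\nabla_3,\nabla_1]=K\,\nabla_2$. Let $\sigma_F:D\to\mathbb R^{14}$ have the components $j=J$, $j_i=\nabla_iJ$ $(1\le i\le 3)$, $j_{ij}=\nabla_i\nabla_jJ$ $(1\le i\le j\le 3)$, $k=K$, $k_i=\nabla_iK$ $(1\le i\le3)$, and put $\Sigma_F=\sigma_F(D)$. The system $F$ is *regular* in $D$ if (1) $f$, $f_{u_1}$, $f_{u_1u_1}$ and $u_1f_{u_1}-f$ vanish nowhere on $D$; (2) $\Sigma_F$ is a smooth (embedded) 3-dimensional submanifold of $\mathbb R^{14}$; (3) near every point of $\Sigma_F$, some three of the five functions $j,j_1,j_2,j_3,k$ are local coordinates on $\Sigma_F$. **Theorem.** Let $F$ be regular in the domain $D$ and $G$ regular in the domain $D'$. Then $F$ and $G$ are locally feedback equivalent if and only if $\Sigma_F=\Sigma_G$.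 -/

import Mathlib

open scoped ContDiff Topology

noncomputable section

namespace FeedbackControl

/-- The space `ℝ³` with coordinates `(x, u, u₁)`, where `z 0 = x`, `z 1 = u`, `z 2 = u₁`.
A control system `ẋ = F (x, u, u̇)` is given by a function `F : Space → ℝ`. -/
abbrev Space : Type := Fin 3 → ℝ

/-- The partial derivative of `h` along the `i`-th coordinate of `(x, u, u₁)`. -/
def pd (i : Fin 3) (h : Space → ℝ) (z : Space) : ℝ :=
  fderiv ℝ h z (Pi.single i 1)

/-- The vector field on `ℝ³` to which the invariant derivation `∇₁` restricts on the system `F`. -/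
def field₁ (F : Space → ℝ) (z : Space) : Space :=
  ![0,
    (z 2 * pd 2 F z - F z) / pd 2 F z,
    (F z - z 2 * pd 2 F z) / pd 2 F z ^ 2 * pd 1 F z]

/-- The vector field on `ℝ³` to which the invariant derivation `∇₂` restricts on the system `F`. -/
def field₂ (F : Space → ℝ) (z : Space) : Space :=
  ![0, 0, F z / pd 2 F z]

/-- The vector field on `ℝ³` to which the invariant derivation `∇₃` restricts on the system `F`. -/
def field₃ (F : Space → ℝ) (z : Space) : Space :=
  ![F z,
    F z / pd 2 F z,
    (pd 0 F z * pd 2 F z + pd 1 F z - z 2 * pd 1 (pd 2 F) z - F z * pd 0 (pd 2 F) z)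
        / pd 2 (pd 2 F) z
      + (z 2 * pd 2 F z - F z) / pd 2 F z ^ 2 * pd 1 F z]

/-- The derivation `∇₁` on the system `F`, applied to a function `h (x, u, u₁)`. -/
def nabla₁ (F h : Space → ℝ) (z : Space) : ℝ := fderiv ℝ h z (field₁ F z)

/-- The derivation `∇₂` on the system `F`, applied to a function `h (x, u, u₁)`. -/
def nabla₂ (F h : Space → ℝ) (z : Space) : ℝ := fderiv ℝ h z (field₂ F z)

/-- The derivation `∇₃` on the system `F`, applied to a function `h (x, u, u₁)`. -/
def nabla₃ (F h : Space → ℝ) (z : Space) : ℝ := fderiv ℝ h z (field₃ F z)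

/-- The basic second order invariant `J`, evaluated on the system `F`. -/
def invJ (F : Space → ℝ) (z : Space) : ℝ :=
  F z ^ 2 * pd 2 (pd 2 F) z / ((z 2 * pd 2 F z - F z) * pd 2 F z ^ 2)

/-- The third order invariant `K`, evaluated on the system `F`: the coefficient in the
commutation relation `[∇₃, ∇₁] = K ∇₂`, read off from the action of both sides on the
coordinate function `u₁` (`∇₂` is a multiple of `∂/∂u₁`, and `∇₂ u₁ = F / F_{u₁}`). -/
def invK (F : Space → ℝ) (z : Space) : ℝ :=
  (nabla₃ F (nabla₁ F (fun w => w 2)) z - nabla₁ F (nabla₃ F (fun w => w 2)) z)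
    / nabla₂ F (fun w => w 2) z

/-- The map `σ_F` into `ℝ¹⁴` with coordinates
`(j, j₁, j₂, j₃, j₁₁, j₁₂, j₁₃, j₂₂, j₂₃, j₃₃, k, k₁, k₂, k₃)`. -/
def sigma (F : Space → ℝ) (z : Space) : Fin 14 → ℝ :=
  ![invJ F z,
    nabla₁ F (invJ F) z, nabla₂ F (invJ F) z, nabla₃ F (invJ F) z,
    nabla₁ F (nabla₁ F (invJ F)) z,
    nabla₁ F (nabla₂ F (invJ F)) z,
    nabla₁ F (nabla₃ F (invJ F)) z,
    nabla₂ F (nabla₂ F (invJ F)) z,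
    nabla₂ F (nabla₃ F (invJ F)) z,
    nabla₃ F (nabla₃ F (invJ F)) z,
    invK F z,
    nabla₁ F (invK F) z, nabla₂ F (invK F) z, nabla₃ F (invK F) z]

/-- The image `Σ_F = σ_F (D)` of a system `F` given on `D`. -/
def Sigma (F : Space → ℝ) (D : Set Space) : Set (Fin 14 → ℝ) :=
  sigma F '' D

/-- `S ⊆ ℝ¹⁴` is, near its point `s`, a smooth 3-dimensional embedded submanifold on which the
three coordinate functions of `ℝ¹⁴` with numbers `a 0, a 1, a 2` are local coordinates. That is,
some open piece `S ∩ W` is the image of an open `V ⊆ ℝ³` under a smooth map `g` which is inverse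
to the three functions. -/
def IsSubmanifoldWithCoordinatesAt (S : Set (Fin 14 → ℝ)) (a : Fin 3 → Fin 14)
    (s : Fin 14 → ℝ) : Prop :=
  ∃ (W : Set (Fin 14 → ℝ)) (V : Set (Fin 3 → ℝ)) (g : (Fin 3 → ℝ) → (Fin 14 → ℝ)),
    IsOpen W ∧ s ∈ W ∧ IsOpen V ∧ ContDiffOn ℝ ∞ g V ∧ g '' V = S ∩ W ∧
      ∀ v ∈ V, ∀ i, g v (a i) = v i

/-- The system `F` is regular in the domain `D`. -/
structure IsRegular (F : Space → ℝ) (D : Set Space) : Prop where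
  isOpen : IsOpen D
  isConnected : IsConnected D
  smooth : ContDiffOn ℝ ∞ F D
  /-- The jets of `F` are regular. -/
  ne_zero : ∀ z ∈ D, F z ≠ 0
  d_ne_zero : ∀ z ∈ D, pd 2 F z ≠ 0
  dd_ne_zero : ∀ z ∈ D, pd 2 (pd 2 F) z ≠ 0
  /-- The denominator of `J` does not vanish, so that `σ_F` is defined on `D`. -/
  denom_ne_zero : ∀ z ∈ D, z 2 * pd 2 F z - F z ≠ 0
  /-- `Σ_F` is a smooth 3-dimensional submanifold, and three of the five functions
  `j, j₁, j₂, j₃, k` (numbers 0, 1, 2, 3, 10) are coordinates on it. -/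
  submanifold : ∀ s ∈ Sigma F D, ∃ a : Fin 3 → Fin 14,
    (∀ i, a i ∈ ({0, 1, 2, 3, 10} : Set (Fin 14))) ∧
      IsSubmanifoldWithCoordinatesAt (Sigma F D) a s

/-- The prolongation of the feedback transformation `(x, u, t) ↦ (X x, U (x, u), t)`, restricted
to the system `x₁ = F (x, u, u₁)`:
`(x, u, u₁) ↦ (X x, U (x, u), U_x (x, u) F (x, u, u₁) + U_u (x, u) u₁)`. -/
def prolong (F : Space → ℝ) (X : ℝ → ℝ) (U : ℝ × ℝ → ℝ) (z : Space) : Space :=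
  ![X (z 0),
    U (z 0, z 1),
    fderiv ℝ U (z 0, z 1) (1, 0) * F z + fderiv ℝ U (z 0, z 1) (0, 1) * z 2]

/-- A local feedback transformation `(x, u) ↦ (X x, U (x, u))` (a local diffeomorphism) carries
the system `F` near `p` to the system `G` near `q`: the prolongation sends `p` to `q`, and
`X_x F = G (X, U, U_x F + U_u u₁)` holds near `p`. -/
def FeedbackEquivalentAt (F : Space → ℝ) (p : Space) (G : Space → ℝ) (q : Space) : Prop :=
  ∃ (X : ℝ → ℝ) (U : ℝ × ℝ → ℝ),
    (∀ᶠ x in 𝓝 (p 0), ContDiffAt ℝ ∞ X x) ∧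
    (∀ᶠ y in 𝓝 (p 0, p 1), ContDiffAt ℝ ∞ U y) ∧
    deriv X (p 0) ≠ 0 ∧
    fderiv ℝ U (p 0, p 1) (0, 1) ≠ 0 ∧
    prolong F X U p = q ∧
    ∀ᶠ z in 𝓝 p, deriv X (z 0) * F z = G (prolong F X U z)

/-- The system `F` on `D` and the system `G` on `D'` are locally feedback equivalent: near each
point of either domain a local feedback transformation identifies the one system with the other
system near some point of the other domain. -/
def LocallyFeedbackEquivalent (F : Space → ℝ) (D : Set Space) (G : Space → ℝ)
    (D' : Set Space) : Prop :=
  (∀ p ∈ D, ∃ q ∈ D', FeedbackEquivalentAt F p G q) ∧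
    (∀ q ∈ D', ∃ p ∈ D, FeedbackEquivalentAt F p G q)

end FeedbackControl

end

/-! The fields `∇₁, ∇₂, ∇₃` are a frame attached invariantly to the system: a prolonged feedback
transformation carries the frame of `F` to that of `G` and preserves `J`
(`IsProlongation.fderiv_frame`, `IsProlongation.invJ_eq`). Hence it preserves `K` and all iterated
frame derivatives, that is `σ`, and equivalent systems have the same `Σ`.

The converse is Cartan's equivalence argument for frames. The structure functions of the frame are
expressed by `J`, `K`, `J₁`, `J₃`, so the frame derivatives of `j, j₁, j₂, j₃, k` are universal
functions of `σ` (`HasRegularJets.fderiv_sigma_frame`). Where three of these five are coordinates on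
the domain, `Σ` therefore determines the frame in them, and identifying points of equal `σ` carries
one frame to the other (`exists_map_frame`). Such a map is automatically a prolonged feedback
transformation: `∇₂` spans `∂/∂u₁`, and `∇₁, ∇₂` span `∂/∂u, ∂/∂u₁`, so the map has the form `(X(x),
U(x,u), *)`; the `x`-component of `∇₃` gives the equation between the systems, and `∇₁ + ∇₃`, which
projects to `F ∂/∂x + u₁ ∂/∂u`, gives the third component.

Regularity speaks of the image `Σ`, while this argument needs `σ_F` to be an immersion
(`IsRegular.fderiv_sigma_injective`). In a chart of `Σ` the matrix `M` of frame derivatives of the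
chart coordinates satisfies `∇_l M = M A_l + B_l M`, so `det M` solves a homogeneous linear equation
and vanishes near each of its zeros. On a connected domain `σ_F` is thus an immersion everywhere or
nowhere, and the latter contradicts Sard's theorem, since the image contains a whole chart. -/

noncomputable section

namespace FeedbackControl

/-! ### Directional derivatives -/

/-- `h` is differentiable at `z`, with derivative `c` in the direction `v`. -/
def HasDirDeriv (h : Space → ℝ) (z v : Space) (c : ℝ) : Prop :=
  DifferentiableAt ℝ h z ∧ fderiv ℝ h z v = c

namespace HasDirDeriv

variable {a b : Space → ℝ} {z v : Space} {a' b' : ℝ}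

theorem const (c : ℝ) (z v : Space) : HasDirDeriv (fun _ => c) z v 0 :=
  ⟨differentiableAt_const c, by simp⟩

theorem coord (i : Fin 3) (z v : Space) : HasDirDeriv (fun w => w i) z v (v i) := by
  have h : HasFDerivAt (fun w : Space => w i)
      (ContinuousLinearMap.proj (R := ℝ) (φ := fun _ : Fin 3 => ℝ) i) z :=
    (ContinuousLinearMap.proj (R := ℝ) (φ := fun _ : Fin 3 => ℝ) i).hasFDerivAt
  exact ⟨h.differentiableAt, by rw [h.fderiv]; rfl⟩

theorem add (ha : HasDirDeriv a z v a') (hb : HasDirDeriv b z v b') :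
    HasDirDeriv (fun w => a w + b w) z v (a' + b') :=
  ⟨ha.1.add hb.1, by rw [(ha.1.hasFDerivAt.fun_add hb.1.hasFDerivAt).fderiv, ← ha.2, ← hb.2]; rfl⟩

theorem sub (ha : HasDirDeriv a z v a') (hb : HasDirDeriv b z v b') :
    HasDirDeriv (fun w => a w - b w) z v (a' - b') :=
  ⟨ha.1.sub hb.1, by rw [(ha.1.hasFDerivAt.fun_sub hb.1.hasFDerivAt).fderiv, ← ha.2, ← hb.2]; rfl⟩

theorem mul (ha : HasDirDeriv a z v a') (hb : HasDirDeriv b z v b') :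
    HasDirDeriv (fun w => a w * b w) z v (a' * b z + a z * b') := by
  refine ⟨ha.1.mul hb.1, ?_⟩
  rw [(ha.1.hasFDerivAt.fun_mul hb.1.hasFDerivAt).fderiv, ← ha.2, ← hb.2]
  simp only [add_apply, smul_apply, smul_eq_mul]
  ring

theorem inv (ha : HasDirDeriv a z v a') (h0 : a z ≠ 0) :
    HasDirDeriv (fun w => (a w)⁻¹) z v (-a' / a z ^ 2) := by
  refine ⟨ha.1.inv h0, ?_⟩
  have h : HasFDerivAt (fun w => (a w)⁻¹) _ z :=
    (hasDerivAt_inv h0).comp_hasFDerivAt z ha.1.hasFDerivAt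
  rw [h.fderiv, ← ha.2]
  simp only [smul_apply, smul_eq_mul]
  ring

theorem div (ha : HasDirDeriv a z v a') (hb : HasDirDeriv b z v b') (h0 : b z ≠ 0) :
    HasDirDeriv (fun w => a w / b w) z v ((a' * b z - a z * b') / b z ^ 2) := by
  have h := ha.mul (hb.inv h0)
  simp only [← div_eq_mul_inv] at h
  refine ⟨h.1, h.2.trans ?_⟩
  field_simp
  ring

theorem sq (ha : HasDirDeriv a z v a') :
    HasDirDeriv (fun w => a w ^ 2) z v (2 * a z * a') := by
  have h := ha.mul ha
  simp only [← pow_two] at h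
  exact ⟨h.1, h.2.trans (by ring)⟩

end HasDirDeriv

theorem fderiv_apply_eq_pd (h : Space → ℝ) (z v : Space) :
    fderiv ℝ h z v = v 0 * pd 0 h z + v 1 * pd 1 h z + v 2 * pd 2 h z := by
  have hv : v = v 0 • Pi.single 0 1 + v 1 • Pi.single 1 1 + v 2 • Pi.single 2 1 := by
    ext i; fin_cases i <;> simp
  conv_lhs => rw [hv]
  simp [pd]

theorem hasDirDeriv_of_differentiableAt {h : Space → ℝ} {z : Space} (hh : DifferentiableAt ℝ h z)
    (v : Space) :
    HasDirDeriv h z v (v 0 * pd 0 h z + v 1 * pd 1 h z + v 2 * pd 2 h z) :=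
  ⟨hh, fderiv_apply_eq_pd h z v⟩

/-! ### Smooth functions on an open set -/

section Smooth

variable {D : Set Space} {h : Space → ℝ} {z : Space}

theorem contDiffOn_fderiv_apply (hD : IsOpen D) (hh : ContDiffOn ℝ ∞ h D) {V : Space → Space}
    (hV : ContDiffOn ℝ ∞ V D) : ContDiffOn ℝ ∞ (fun z => fderiv ℝ h z (V z)) D :=
  (hh.fderiv_of_isOpen hD (by simp)).clm_apply hV

theorem contDiffOn_pd (hD : IsOpen D) (hh : ContDiffOn ℝ ∞ h D) (i : Fin 3) :
    ContDiffOn ℝ ∞ (pd i h) D :=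
  contDiffOn_fderiv_apply hD hh contDiffOn_const

theorem contDiffOn_coord (i : Fin 3) : ContDiffOn ℝ ∞ (fun w : Space => w i) D :=
  (contDiff_apply ℝ ℝ i).contDiffOn

theorem differentiableAt_of_contDiffOn {E : Type*} [NormedAddCommGroup E] [NormedSpace ℝ E]
    {h : Space → E} (hD : IsOpen D) (hh : ContDiffOn ℝ ∞ h D) (hz : z ∈ D) :
    DifferentiableAt ℝ h z :=
  (hh.contDiffAt (hD.mem_nhds hz)).differentiableAt (by simp)

theorem fderiv_eq_of_eqOn (hD : IsOpen D) {h' : Space → ℝ} (hh : Set.EqOn h h' D) (hz : z ∈ D) :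
    fderiv ℝ h z = fderiv ℝ h' z :=
  (Filter.eventuallyEq_of_mem (hD.mem_nhds hz) hh).fderiv_eq

theorem pd_comm (hD : IsOpen D) (hh : ContDiffOn ℝ ∞ h D) (hz : z ∈ D) (i j : Fin 3) :
    pd i (pd j h) z = pd j (pd i h) z := by
  have hs : IsSymmSndFDerivAt ℝ h z :=
    (hh.contDiffAt (hD.mem_nhds hz)).isSymmSndFDerivAt
      (by simp only [minSmoothness_of_isRCLikeNormedField]; exact WithTop.coe_le_coe.2 le_top)
  have hd : DifferentiableAt ℝ (fderiv ℝ h) z :=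
    differentiableAt_of_contDiffOn hD (hh.fderiv_of_isOpen hD (m := ∞) (by simp)) hz
  have key : ∀ a b : Fin 3, pd a (pd b h) z
      = fderiv ℝ (fderiv ℝ h) z (Pi.single a 1) (Pi.single b 1) := fun a b => by
    unfold pd
    rw [fderiv_clm_apply hd (differentiableAt_const _)]
    simp
  rw [key, key]
  exact hs _ _

/-- The commutator of two vector fields, acting on a function, through their components. -/
theorem fderiv_commutator (hD : IsOpen D) (hh : ContDiffOn ℝ ∞ h D) {V W : Space → Space}
    (hV : ContDiffOn ℝ ∞ V D) (hW : ContDiffOn ℝ ∞ W D) (hz : z ∈ D) :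
    fderiv ℝ (fun y => fderiv ℝ h y (W y)) z (V z) - fderiv ℝ (fun y => fderiv ℝ h y (V y)) z (W z)
      = ∑ i, (fderiv ℝ (fun y => W y i) z (V z)
        - fderiv ℝ (fun y => V y i) z (W z)) * pd i h z := by
  have key : ∀ {A B : Space → Space}, ContDiffOn ℝ ∞ A D → ContDiffOn ℝ ∞ B D →
      fderiv ℝ (fun y => fderiv ℝ h y (B y)) z (A z)
        = ∑ i, (fderiv ℝ (fun y => B y i) z (A z) * pd i h z
          + B z i * fderiv ℝ (pd i h) z (A z)) := by
    intro A B hA hB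
    have hc : ∀ i, ContDiffOn ℝ ∞ (fun y => B y i) D := fun i => contDiffOn_pi.1 hB i
    have h1 : ∀ i, HasDirDeriv (fun y => B y i * pd i h y) z (A z)
        (fderiv ℝ (fun y => B y i) z (A z) * pd i h z + B z i * fderiv ℝ (pd i h) z (A z)) :=
      fun i => HasDirDeriv.mul ⟨differentiableAt_of_contDiffOn hD (hc i) hz, rfl⟩
        ⟨differentiableAt_of_contDiffOn hD (contDiffOn_pd hD hh i) hz, rfl⟩
    have h2 := (((h1 0).add (h1 1)).add (h1 2)).2
    rw [Fin.sum_univ_three, ← h2]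
    congr 2
    funext y
    exact fderiv_apply_eq_pd h y (B y)
  rw [key hV hW, key hW hV]
  simp only [fderiv_apply_eq_pd (pd _ h), Fin.sum_univ_three]
  rw [pd_comm hD hh hz 1 0, pd_comm hD hh hz 2 0, pd_comm hD hh hz 2 1]
  ring

end Smooth

/-! ### The frame of a system with regular jets -/

/-- The jets of the system `F` are regular at all points of the open set `D`. -/
structure HasRegularJets (F : Space → ℝ) (D : Set Space) : Prop where
  isOpen : IsOpen D
  smooth : ContDiffOn ℝ ∞ F D
  ne_zero : ∀ z ∈ D, F z ≠ 0
  d_ne_zero : ∀ z ∈ D, pd 2 F z ≠ 0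
  dd_ne_zero : ∀ z ∈ D, pd 2 (pd 2 F) z ≠ 0
  denom_ne_zero : ∀ z ∈ D, z 2 * pd 2 F z - F z ≠ 0

theorem IsRegular.hasRegularJets {F : Space → ℝ} {D : Set Space} (hF : IsRegular F D) :
    HasRegularJets F D :=
  ⟨hF.isOpen, hF.smooth, hF.ne_zero, hF.d_ne_zero, hF.dd_ne_zero, hF.denom_ne_zero⟩

theorem HasRegularJets.mono {F : Space → ℝ} {D N : Set Space} (hF : HasRegularJets F D)
    (hN : IsOpen N) (hND : N ⊆ D) : HasRegularJets F N :=
  ⟨hN, hF.smooth.mono hND, fun z hz => hF.ne_zero z (hND hz), fun z hz => hF.d_ne_zero z (hND hz),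
    fun z hz => hF.dd_ne_zero z (hND hz), fun z hz => hF.denom_ne_zero z (hND hz)⟩


section Frame

variable {F : Space → ℝ} {D : Set Space}

theorem HasRegularJets.contDiffOn_field₁ (hF : HasRegularJets F D) :
    ContDiffOn ℝ ∞ (field₁ F) D := by
  have h2 := contDiffOn_pd hF.isOpen hF.smooth 2
  have h1 := contDiffOn_pd hF.isOpen hF.smooth 1
  have hc := contDiffOn_coord (D := D) 2
  refine contDiffOn_pi.2 fun i => ?_
  fin_cases i
  · exact contDiffOn_const
  · exact ((hc.mul h2).sub hF.smooth).div h2 hF.d_ne_zero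
  · exact ((hF.smooth.sub (hc.mul h2)).div (h2.pow 2)
      fun z hz => pow_ne_zero 2 (hF.d_ne_zero z hz)).mul h1

theorem HasRegularJets.contDiffOn_field₂ (hF : HasRegularJets F D) :
    ContDiffOn ℝ ∞ (field₂ F) D := by
  have h2 := contDiffOn_pd hF.isOpen hF.smooth 2
  refine contDiffOn_pi.2 fun i => ?_
  fin_cases i
  · exact contDiffOn_const
  · exact contDiffOn_const
  · exact hF.smooth.div h2 hF.d_ne_zero

theorem HasRegularJets.contDiffOn_field₃ (hF : HasRegularJets F D) :
    ContDiffOn ℝ ∞ (field₃ F) D := by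
  have hp := fun i => contDiffOn_pd hF.isOpen hF.smooth i
  have hpp := fun i => contDiffOn_pd hF.isOpen (hp 2) i
  have hc := contDiffOn_coord (D := D) 2
  refine contDiffOn_pi.2 fun i => ?_
  fin_cases i
  · exact hF.smooth
  · exact hF.smooth.div (hp 2) hF.d_ne_zero
  · exact ((((((hp 0).mul (hp 2)).add (hp 1)).sub (hc.mul (hpp 1))).sub
      (hF.smooth.mul (hpp 0))).div (hpp 2) hF.dd_ne_zero).add
      ((((hc.mul (hp 2)).sub hF.smooth).div ((hp 2).pow 2)
      fun z hz => pow_ne_zero 2 (hF.d_ne_zero z hz)).mul (hp 1))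

theorem HasRegularJets.contDiffOn_nabla₁ (hF : HasRegularJets F D) {h : Space → ℝ}
    (hh : ContDiffOn ℝ ∞ h D) : ContDiffOn ℝ ∞ (nabla₁ F h) D :=
  contDiffOn_fderiv_apply hF.isOpen hh hF.contDiffOn_field₁

theorem HasRegularJets.contDiffOn_nabla₂ (hF : HasRegularJets F D) {h : Space → ℝ}
    (hh : ContDiffOn ℝ ∞ h D) : ContDiffOn ℝ ∞ (nabla₂ F h) D :=
  contDiffOn_fderiv_apply hF.isOpen hh hF.contDiffOn_field₂

theorem HasRegularJets.contDiffOn_nabla₃ (hF : HasRegularJets F D) {h : Space → ℝ}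
    (hh : ContDiffOn ℝ ∞ h D) : ContDiffOn ℝ ∞ (nabla₃ F h) D :=
  contDiffOn_fderiv_apply hF.isOpen hh hF.contDiffOn_field₃

theorem HasRegularJets.contDiffOn_invJ (hF : HasRegularJets F D) : ContDiffOn ℝ ∞ (invJ F) D := by
  have h2 := contDiffOn_pd hF.isOpen hF.smooth 2
  have h22 := contDiffOn_pd hF.isOpen h2 2
  have hc := contDiffOn_coord (D := D) 2
  exact ((hF.smooth.pow 2).mul h22).div (((hc.mul h2).sub hF.smooth).mul (h2.pow 2))
    fun z hz => mul_ne_zero (hF.denom_ne_zero z hz) (pow_ne_zero 2 (hF.d_ne_zero z hz))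

theorem nabla₂_coord_two (F : Space → ℝ) (z : Space) :
    nabla₂ F (fun w => w 2) z = F z / pd 2 F z :=
  (HasDirDeriv.coord 2 z _).2

theorem HasRegularJets.contDiffOn_invK (hF : HasRegularJets F D) : ContDiffOn ℝ ∞ (invK F) D := by
  have hc := contDiffOn_coord (D := D) 2
  refine ((hF.contDiffOn_nabla₃ (hF.contDiffOn_nabla₁ hc)).sub
    (hF.contDiffOn_nabla₁ (hF.contDiffOn_nabla₃ hc))).div (hF.contDiffOn_nabla₂ hc) fun z hz => ?_
  rw [nabla₂_coord_two]
  exact div_ne_zero (hF.ne_zero z hz) (hF.d_ne_zero z hz)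

theorem HasRegularJets.contDiffOn_sigma (hF : HasRegularJets F D) : ContDiffOn ℝ ∞ (sigma F) D := by
  have hJ := hF.contDiffOn_invJ
  have hK := hF.contDiffOn_invK
  have h1 := fun {h} => hF.contDiffOn_nabla₁ (h := h)
  have h2 := fun {h} => hF.contDiffOn_nabla₂ (h := h)
  have h3 := fun {h} => hF.contDiffOn_nabla₃ (h := h)
  refine contDiffOn_pi.2 fun i => ?_
  fin_cases i
  exacts [hJ, h1 hJ, h2 hJ, h3 hJ, h1 (h1 hJ), h1 (h2 hJ), h1 (h3 hJ), h2 (h2 hJ), h2 (h3 hJ),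
    h3 (h3 hJ), hK, h1 hK, h2 hK, h3 hK]

theorem HasRegularJets.invJ_ne_zero (hF : HasRegularJets F D) {z : Space} (hz : z ∈ D) :
    invJ F z ≠ 0 :=
  div_ne_zero (mul_ne_zero (pow_ne_zero 2 (hF.ne_zero z hz)) (hF.dd_ne_zero z hz))
    (mul_ne_zero (hF.denom_ne_zero z hz) (pow_ne_zero 2 (hF.d_ne_zero z hz)))

/-- The commutation relation `[∇₁, ∇₂] = -J ∇₁`. -/
theorem HasRegularJets.nabla₁_nabla₂ (hF : HasRegularJets F D) {h : Space → ℝ}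
    (hh : ContDiffOn ℝ ∞ h D)
    {z : Space} (hz : z ∈ D) :
    nabla₁ F (nabla₂ F h) z - nabla₂ F (nabla₁ F h) z = -(invJ F z * nabla₁ F h z) := by
  have hp := fun i => contDiffOn_pd hF.isOpen hF.smooth i
  have hF0 := fun v => hasDirDeriv_of_differentiableAt
    (differentiableAt_of_contDiffOn hF.isOpen hF.smooth hz) v
  have hp' := fun i v => hasDirDeriv_of_differentiableAt
    (differentiableAt_of_contDiffOn hF.isOpen (hp i) hz) v
  have hc := fun v => HasDirDeriv.coord 2 z v
  have n1 := hF.d_ne_zero z hz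
  have n0 := hF.denom_ne_zero z hz
  have key := fderiv_commutator hF.isOpen hh hF.contDiffOn_field₁ hF.contDiffOn_field₂ hz
  refine key.trans ?_
  have e1 := fun v => ((((hc v).mul (hp' 2 v)).sub (hF0 v)).div (hp' 2 v) n1).2
  have e2 := fun v => ((((hF0 v).sub ((hc v).mul (hp' 2 v))).div (hp' 2 v).sq
    (pow_ne_zero 2 n1)).mul (hp' 1 v)).2
  have e3 := fun v => ((hF0 v).div (hp' 2 v) n1).2
  have e4 := fun v => (HasDirDeriv.const 0 z v).2
  have q := pd_comm hF.isOpen hF.smooth hz 2 1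
  simp only [nabla₁, fderiv_apply_eq_pd h, Fin.sum_univ_three, field₁, field₂, invJ,
    Matrix.cons_val_zero, Matrix.cons_val_one, Matrix.cons_val, e1, e2, e3, e4, q]
  rw [mul_comm (z 2)] at n0 ⊢
  field_simp
  ring

/-- The commutation relation `[∇₃, ∇₁] = K ∇₂`. -/
theorem HasRegularJets.nabla₃_nabla₁ (hF : HasRegularJets F D) {h : Space → ℝ}
    (hh : ContDiffOn ℝ ∞ h D)
    {z : Space} (hz : z ∈ D) :
    nabla₃ F (nabla₁ F h) z - nabla₁ F (nabla₃ F h) z = invK F z * nabla₂ F h z := by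
  have hp := fun i => contDiffOn_pd hF.isOpen hF.smooth i
  have hF0 := fun v => hasDirDeriv_of_differentiableAt
    (differentiableAt_of_contDiffOn hF.isOpen hF.smooth hz) v
  have hp' := fun i v => hasDirDeriv_of_differentiableAt
    (differentiableAt_of_contDiffOn hF.isOpen (hp i) hz) v
  have hc := fun v => HasDirDeriv.coord 2 z v
  have n1 := hF.d_ne_zero z hz
  have n2 := hF.dd_ne_zero z hz
  have nF := hF.ne_zero z hz
  have key := fderiv_commutator hF.isOpen hh hF.contDiffOn_field₃ hF.contDiffOn_field₁ hz
  refine key.trans ?_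
  have f1 : nabla₁ F (fun w => w 2) = fun y => field₁ F y 2 :=
    funext fun y => (HasDirDeriv.coord 2 y _).2
  have f3 : nabla₃ F (fun w => w 2) = fun y => field₃ F y 2 :=
    funext fun y => (HasDirDeriv.coord 2 y _).2
  have hK : invK F z * (F z / pd 2 F z) = fderiv ℝ (fun y => field₁ F y 2) z (field₃ F z)
      - fderiv ℝ (fun y => field₃ F y 2) z (field₁ F z) := by
    rw [invK, nabla₂_coord_two, f1, f3]
    exact div_mul_cancel₀ _ (div_ne_zero nF n1)
  rw [Fin.sum_univ_three, ← hK]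
  have e1 := fun v => ((((hc v).mul (hp' 2 v)).sub (hF0 v)).div (hp' 2 v) n1).2
  have e3 := fun v => ((hF0 v).div (hp' 2 v) n1).2
  have e4 := fun v => (HasDirDeriv.const 0 z v).2
  simp only [nabla₂, fderiv_apply_eq_pd h, field₁, field₂, field₃,
    Matrix.cons_val_zero, Matrix.cons_val_one, Matrix.cons_val, e1, e3, e4, fderiv_apply_eq_pd F]
  field_simp
  ring

end Frame

/-! ### The last structure equation, and frame derivatives as functions of `σ` -/

section Structure

variable {F : Space → ℝ} {D : Set Space}

/-- The `x`- and `u`-components of both sides agree by computation, and `∇₂` is a multiple of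
`∂/∂u₁`, so some `b` absorbs what is left. Its value would involve third derivatives of `F`; it is
left open here and found later from the other relations. -/
theorem HasRegularJets.exists_nabla₂_nabla₃ (hF : HasRegularJets F D) : ∃ b : Space → ℝ,
    ∀ h : Space → ℝ, ContDiffOn ℝ ∞ h D → ∀ z ∈ D,
      nabla₂ F (nabla₃ F h) z - nabla₃ F (nabla₂ F h) z
        = nabla₃ F h z - invJ F z * nabla₁ F h z + b z * nabla₂ F h z := by
  refine ⟨fun z => (fderiv ℝ (fun y => field₃ F y 2) z (field₂ F z)
    - fderiv ℝ (fun y => field₂ F y 2) z (field₃ F z) - field₃ F z 2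
    + invJ F z * field₁ F z 2) / (F z / pd 2 F z), fun h hh z hz => ?_⟩
  have hp := fun i => contDiffOn_pd hF.isOpen hF.smooth i
  have hF0 := fun v => hasDirDeriv_of_differentiableAt
    (differentiableAt_of_contDiffOn hF.isOpen hF.smooth hz) v
  have hp' := fun i v => hasDirDeriv_of_differentiableAt
    (differentiableAt_of_contDiffOn hF.isOpen (hp i) hz) v
  have n1 := hF.d_ne_zero z hz
  have nF := hF.ne_zero z hz
  have n0 := hF.denom_ne_zero z hz
  have e3 := fun v => ((hF0 v).div (hp' 2 v) n1).2
  have e4 := fun v => (HasDirDeriv.const 0 z v).2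
  have key := fderiv_commutator hF.isOpen hh hF.contDiffOn_field₂ hF.contDiffOn_field₃ hz
  refine key.trans ?_
  have h2 : nabla₂ F h z = F z / pd 2 F z * pd 2 h z := by
    simp [nabla₂, fderiv_apply_eq_pd h, field₂]
  have c0 : fderiv ℝ (fun y => field₃ F y 0) z (field₂ F z)
      - fderiv ℝ (fun y => field₂ F y 0) z (field₃ F z)
      = field₃ F z 0 - invJ F z * field₁ F z 0 := by
    simp only [field₂, field₃, field₁, Matrix.cons_val_zero, Matrix.cons_val_one,
      Matrix.cons_val, e4, fderiv_apply_eq_pd F]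
    field_simp
    ring
  have c1 : fderiv ℝ (fun y => field₃ F y 1) z (field₂ F z)
      - fderiv ℝ (fun y => field₂ F y 1) z (field₃ F z)
      = field₃ F z 1 - invJ F z * field₁ F z 1 := by
    simp only [field₂, field₃, field₁, Matrix.cons_val_zero, Matrix.cons_val_one,
      Matrix.cons_val, e4, e3, invJ]
    rw [mul_comm (z 2)] at n0 ⊢
    field_simp
    ring
  rw [Fin.sum_univ_three, c0, c1, h2, ← mul_assoc, div_mul_cancel₀ _ (div_ne_zero nF n1),
    nabla₃, nabla₁, fderiv_apply_eq_pd h, fderiv_apply_eq_pd h]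
  ring

/-- The commutation relation `[∇₂, ∇₃] = ∇₃ - J ∇₁ - (J₁ + J₃) / J ∇₂`. Its last coefficient is
forced by the Jacobi identity. -/
theorem HasRegularJets.nabla₂_nabla₃ (hF : HasRegularJets F D) {h : Space → ℝ}
    (hh : ContDiffOn ℝ ∞ h D)
    {z : Space} (hz : z ∈ D) :
    nabla₂ F (nabla₃ F h) z - nabla₃ F (nabla₂ F h) z
      = nabla₃ F h z - invJ F z * nabla₁ F h z
        - (nabla₁ F (invJ F) z + nabla₃ F (invJ F) z) / invJ F z * nabla₂ F h z := by
  obtain ⟨b, hb⟩ := hF.exists_nabla₂_nabla₃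
  rw [hb h hh z hz]
  suffices H : b z = -((nabla₁ F (invJ F) z + nabla₃ F (invJ F) z) / invJ F z) by rw [H]; ring
  have hD := hF.isOpen
  -- The Jacobi identity is tested on the coordinate `u`, which `∇₂` kills. With `y = ∇₁ u` and `c =
  -- ∇₃ u` the relations read `∇₂ y = J y`, `∇₃ y = ∇₁ c`, `∇₂ c = c - J y`; applying `[∇₂, ∇₃]` to
  -- `y` then determines `b`, as `y` and `J` do not vanish.
  have hu : ContDiffOn ℝ ∞ (fun w : Space => w 1) D := contDiffOn_coord 1
  have hy := hF.contDiffOn_nabla₁ hu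
  have hc := hF.contDiffOn_nabla₃ hu
  have hJ := hF.contDiffOn_invJ
  have nJ := hF.invJ_ne_zero hz
  have u2 : nabla₂ F (fun w => w 1) = fun _ => 0 :=
    funext fun y => (HasDirDeriv.coord 1 y _).2
  set y := nabla₁ F (fun w => w 1) with hydef
  set c := nabla₃ F (fun w => w 1) with hcdef
  have ny : y z ≠ 0 := by
    have : y z = (z 2 * pd 2 F z - F z) / pd 2 F z := (HasDirDeriv.coord 1 z _).2
    rw [this]
    exact div_ne_zero (hF.denom_ne_zero z hz) (hF.d_ne_zero z hz)
  have z1 : ∀ w, nabla₁ F (fun _ => 0) w = 0 := fun w => (HasDirDeriv.const 0 w _).2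
  have z3 : ∀ w, nabla₃ F (fun _ => 0) w = 0 := fun w => (HasDirDeriv.const 0 w _).2
  have r1 : ∀ w ∈ D, nabla₂ F y w = invJ F w * y w := fun w hw => by
    have := hF.nabla₁_nabla₂ hu hw
    rw [u2, z1, ← hydef] at this
    linarith
  have r2 : ∀ w ∈ D, nabla₃ F y w = nabla₁ F c w := fun w hw => by
    have := hF.nabla₃_nabla₁ hu hw
    rw [u2, ← hydef, ← hcdef] at this
    linarith
  have r3 : ∀ w ∈ D, nabla₂ F c w = c w - invJ F w * y w := fun w hw => by
    have := hb _ hu w hw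
    rw [u2, z3, ← hydef, ← hcdef] at this
    linarith
  have dd := fun {h : Space → ℝ} (hh : ContDiffOn ℝ ∞ h D) =>
    differentiableAt_of_contDiffOn hD hh hz
  have s1 : nabla₃ F (nabla₂ F y) z = nabla₃ F (invJ F) z * y z + invJ F z * nabla₃ F y z := by
    rw [nabla₃, fderiv_eq_of_eqOn hD r1 hz]
    exact (HasDirDeriv.mul ⟨dd hJ, rfl⟩ ⟨dd hy, rfl⟩).2
  have s2 : nabla₂ F (nabla₃ F y) z = nabla₂ F (nabla₁ F c) z := by
    rw [nabla₂, fderiv_eq_of_eqOn hD r2 hz]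
    rfl
  have s3 : nabla₁ F (nabla₂ F c) z
      = nabla₁ F c z - (nabla₁ F (invJ F) z * y z + invJ F z * nabla₁ F y z) := by
    rw [nabla₁, fderiv_eq_of_eqOn hD r3 hz]
    exact (HasDirDeriv.sub ⟨dd hc, rfl⟩ (HasDirDeriv.mul ⟨dd hJ, rfl⟩ ⟨dd hy, rfl⟩)).2
  have t1 := hb y hy z hz
  have t2 := hF.nabla₁_nabla₂ hc hz
  have t3 := r1 z hz
  have t4 := r2 z hz
  rw [s1, s2, t3, t4] at t1
  rw [s3] at t2
  have : b z * invJ F z * y z = -(nabla₁ F (invJ F) z + nabla₃ F (invJ F) z) * y z := by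
    linear_combination -t1 - t2
  rw [← neg_div, eq_div_iff nJ]
  exact mul_right_cancel₀ ny this

/-- The frame `∇₁, ∇₂, ∇₃`. -/
def frame (F : Space → ℝ) : Fin 3 → Space → Space := ![field₁ F, field₂ F, field₃ F]

/-- The derivatives of the coordinates number `0, 1, 2, 3, 10` of `σ_F` along the frame, as
functions of `σ_F`. -/
def frameDeriv (i : Fin 3) (a : Fin 14) (s : Fin 14 → ℝ) : ℝ :=
  if a = 0 then ![s 1, s 2, s 3] i
  -- `σ` stores `∇ᵢ∇ⱼJ` only for `i ≤ j`; the entries for `i > j` are recovered from the three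
  -- commutation relations.
  else if a = 1 then ![s 4, s 5 + s 0 * s 1, s 6 + s 10 * s 2] i
  else if a = 2 then ![s 5, s 7, s 8 - (s 3 - s 0 * s 1 - (s 1 + s 3) / s 0 * s 2)] i
  else if a = 3 then ![s 6, s 8, s 9] i
  -- This is meant for the index `10` of `k`; for the indices outside the five it is a junk value.
  else ![s 11, s 12, s 13] i

theorem contDiffAt_frameDeriv (i : Fin 3) (a : Fin 14) {s : Fin 14 → ℝ} (hs : s 0 ≠ 0) :
    ContDiffAt ℝ ∞ (frameDeriv i a) s := by
  have h : ∀ k : Fin 14, ContDiffAt ℝ ∞ (fun s : Fin 14 → ℝ => s k) s := fun k =>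
    (contDiff_apply ℝ ℝ k).contDiffAt
  unfold frameDeriv
  by_cases h0 : a = 0
  · simp only [h0, if_true]
    fin_cases i <;> apply h
  by_cases h1 : a = 1
  · simp only [h1]
    fin_cases i
    exacts [h 4, (h 5).add ((h 0).mul (h 1)), (h 6).add ((h 10).mul (h 2))]
  by_cases h2 : a = 2
  · simp only [h2]
    fin_cases i
    exacts [h 5, h 7, (h 8).sub (((h 3).sub ((h 0).mul (h 1))).sub
      ((((h 1).add (h 3)).div (h 0) hs).mul (h 2)))]
  by_cases h3 : a = 3
  · simp only [h3]
    fin_cases i <;> apply h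
  · simp only [h0, h1, h2, h3, if_false]
    fin_cases i <;> apply h

/-- Most entries are components of `σ` by definition; the three with the derivatives in the wrong
order are the structure equations applied to `J`. The formula does not mention the system, which is
what lets two systems with the same `Σ` be compared. -/
theorem HasRegularJets.fderiv_sigma_frame (hF : HasRegularJets F D) {z : Space} (hz : z ∈ D)
    (i : Fin 3)
    {a : Fin 14} (ha : a ∈ ({0, 1, 2, 3, 10} : Set (Fin 14))) :
    fderiv ℝ (fun w => sigma F w a) z (frame F i z) = frameDeriv i a (sigma F z) := by
  have hJ := hF.contDiffOn_invJ
  have c12 := hF.nabla₁_nabla₂ hJ hz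
  have c31 := hF.nabla₃_nabla₁ hJ hz
  have c23 := hF.nabla₂_nabla₃ hJ hz
  simp only [Set.mem_insert_iff, Set.mem_singleton_iff] at ha
  rcases ha with rfl | rfl | rfl | rfl | rfl <;> fin_cases i <;>
    first
    | rfl
    | (change nabla₂ F (nabla₁ F (invJ F)) z = nabla₁ F (nabla₂ F (invJ F)) z
        + invJ F z * nabla₁ F (invJ F) z; linarith)
    | (change nabla₃ F (nabla₁ F (invJ F)) z = nabla₁ F (nabla₃ F (invJ F)) z
        + invK F z * nabla₂ F (invJ F) z; linarith)
    | (change nabla₃ F (nabla₂ F (invJ F)) z = nabla₂ F (nabla₃ F (invJ F)) z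
        - (nabla₃ F (invJ F) z - invJ F z * nabla₁ F (invJ F) z
          - (nabla₁ F (invJ F) z + nabla₃ F (invJ F) z) / invJ F z * nabla₂ F (invJ F) z)
       linarith)

end Structure

/-! ### Nondegeneracy of the map `σ_F` -/

/-- A function whose gradient is bounded by a multiple of its value vanishes near each zero. -/
theorem eventually_eq_zero_of_norm_fderiv_le {d : Space → ℝ} {z₀ : Space} {C : ℝ}
    (h : ∀ᶠ z in 𝓝 z₀, DifferentiableAt ℝ d z ∧ ‖fderiv ℝ d z‖ ≤ C * |d z|) (h0 : d z₀ = 0) :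
    ∀ᶠ z in 𝓝 z₀, d z = 0 := by
  obtain ⟨r, hr, hball⟩ := Metric.eventually_nhds_iff_ball.1 h
  filter_upwards [Metric.ball_mem_nhds z₀ hr] with z hz
  -- Grönwall's inequality along the segment from `z₀` to `z`.
  set γ : ℝ → Space := fun t => z₀ + t • (z - z₀) with hγ
  have hmem : ∀ t ∈ Set.Icc (0 : ℝ) 1, γ t ∈ Metric.ball z₀ r := fun t ht => by
    rw [Metric.mem_ball, dist_eq_norm] at hz ⊢
    simp only [hγ, add_sub_cancel_left, norm_smul, Real.norm_eq_abs, abs_of_nonneg ht.1]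
    exact (mul_le_of_le_one_left (norm_nonneg _) ht.2).trans_lt hz
  have hγd : ∀ t, HasDerivAt γ (z - z₀) t := fun t => by
    have h := ((hasDerivAt_id t).smul_const (z - z₀)).const_add z₀
    rw [one_smul] at h
    exact h
  have hd : ∀ t ∈ Set.Icc (0 : ℝ) 1,
      HasDerivAt (fun t => d (γ t)) (fderiv ℝ d (γ t) (z - z₀)) t := fun t ht =>
    (hball _ (hmem t ht)).1.hasFDerivAt.comp_hasDerivAt t (hγd t)
  have key := eq_zero_of_abs_deriv_le_mul_abs_self_of_eq_zero_right (K := C * ‖z - z₀‖)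
    (fun t ht => (hd t ht).continuousAt.continuousWithinAt)
    (fun t ht => (hd t (Set.Ico_subset_Icc_self ht)).hasDerivWithinAt)
    (by simp [hγ, h0])
    (fun t ht => by
      refine (ContinuousLinearMap.le_opNorm _ _).trans ?_
      refine (mul_le_mul_of_nonneg_right (hball _ (hmem t (Set.Ico_subset_Icc_self ht))).2
        (norm_nonneg _)).trans_eq ?_
      rw [Real.norm_eq_abs]
      ring) 1 (by simp)
  simpa [hγ] using key

/-- If the derivative of a matrix `M` is `M * A + B * M`, then that of its determinant is
`(trace A + trace B) * det M`. -/
theorem hasDirDeriv_det {M : Space → Matrix (Fin 3) (Fin 3) ℝ} {z v : Space}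
    {A B : Matrix (Fin 3) (Fin 3) ℝ}
    (h : ∀ i k, HasDirDeriv (fun w => M w i k) z v ((M z * A + B * M z) i k)) :
    HasDirDeriv (fun w => (M w).det) z v ((A.trace + B.trace) * (M z).det) := by
  have H := (((((((h 0 0).mul (h 1 1)).mul (h 2 2)).sub (((h 0 0).mul (h 1 2)).mul (h 2 1))).sub
    (((h 0 1).mul (h 1 0)).mul (h 2 2))).add (((h 0 1).mul (h 1 2)).mul (h 2 0))).add
    (((h 0 2).mul (h 1 0)).mul (h 2 1))).sub (((h 0 2).mul (h 1 1)).mul (h 2 0))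
  simp only [Matrix.det_fin_three]
  refine ⟨H.1, H.2.trans ?_⟩
  simp only [Matrix.add_apply, Matrix.mul_apply, Fin.sum_univ_three, Matrix.trace,
    Matrix.diag_apply]
  ring

section

variable {F : Space → ℝ} {D : Set Space}

theorem HasRegularJets.contDiffOn_frame (hF : HasRegularJets F D) (i : Fin 3) :
    ContDiffOn ℝ ∞ (frame F i) D := by
  fin_cases i
  exacts [hF.contDiffOn_field₁, hF.contDiffOn_field₂, hF.contDiffOn_field₃]

/-- The three structure equations in uniform index notation. Of the coefficients only continuity
matters, for the Grönwall argument. -/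
theorem HasRegularJets.exists_frame_commutator (hF : HasRegularJets F D) :
    ∃ C : Fin 3 → Fin 3 → Fin 3 → Space → ℝ, (∀ l i r, ContinuousOn (C l i r) D) ∧
      ∀ h : Space → ℝ, ContDiffOn ℝ ∞ h D → ∀ z ∈ D, ∀ l i,
        fderiv ℝ (fun w => fderiv ℝ h w (frame F i w)) z (frame F l z)
          = fderiv ℝ (fun w => fderiv ℝ h w (frame F l w)) z (frame F i z)
            + ∑ r, C l i r z * fderiv ℝ h z (frame F r z) := by
  set b : Space → ℝ := fun z => (nabla₁ F (invJ F) z + nabla₃ F (invJ F) z) / invJ F z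
  have hJ := hF.contDiffOn_invJ
  have cJ := hJ.continuousOn
  have cK := hF.contDiffOn_invK.continuousOn
  have cb : ContinuousOn b D :=
    ((hF.contDiffOn_nabla₁ hJ).add (hF.contDiffOn_nabla₃ hJ)).continuousOn.div cJ fun z hz => hF.invJ_ne_zero hz
  -- The entry `C l i r` is the coefficient of the `r`-th field in the bracket of the `l`-th and the
  -- `i`-th, hence antisymmetric in `l, i`.
  refine ⟨![![fun _ _ => 0, ![fun z => -invJ F z, fun _ => 0, fun _ => 0],
      ![fun _ => 0, fun z => -invK F z, fun _ => 0]],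
    ![![fun z => invJ F z, fun _ => 0, fun _ => 0], fun _ _ => 0,
      ![fun z => -invJ F z, fun z => -b z, fun _ => 1]],
    ![![fun _ => 0, fun z => invK F z, fun _ => 0],
      ![fun z => invJ F z, fun z => b z, fun _ => -1], fun _ _ => 0]], ?_, ?_⟩
  · intro l i r
    fin_cases l <;> fin_cases i <;> fin_cases r <;>
      first
      | exact continuousOn_const
      | exact cJ
      | exact cJ.neg
      | exact cK
      | exact cK.neg
      | exact cb
      | exact cb.neg
  · intro h hh z hz l i
    have c12 := hF.nabla₁_nabla₂ hh hz
    have c31 := hF.nabla₃_nabla₁ hh hz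
    have c23 := hF.nabla₂_nabla₃ hh hz
    rw [Fin.sum_univ_three]
    change _ = _ + (_ * nabla₁ F h z + _ * nabla₂ F h z + _ * nabla₃ F h z)
    fin_cases l <;> fin_cases i
    · change nabla₁ F (nabla₁ F h) z = nabla₁ F (nabla₁ F h) z
        + (0 * _ + 0 * _ + 0 * _)
      ring
    · change nabla₁ F (nabla₂ F h) z = nabla₂ F (nabla₁ F h) z
        + (-invJ F z * _ + 0 * _ + 0 * _)
      linarith
    · change nabla₁ F (nabla₃ F h) z = nabla₃ F (nabla₁ F h) z
        + (0 * _ + -invK F z * _ + 0 * _)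
      linarith
    · change nabla₂ F (nabla₁ F h) z = nabla₁ F (nabla₂ F h) z
        + (invJ F z * _ + 0 * _ + 0 * _)
      linarith
    · change nabla₂ F (nabla₂ F h) z = nabla₂ F (nabla₂ F h) z
        + (0 * _ + 0 * _ + 0 * _)
      ring
    · change nabla₂ F (nabla₃ F h) z = nabla₃ F (nabla₂ F h) z
        + (-invJ F z * _ + -b z * _ + 1 * _)
      linarith
    · change nabla₃ F (nabla₁ F h) z = nabla₁ F (nabla₃ F h) z
        + (0 * _ + invK F z * _ + 0 * _)
      linarith
    · change nabla₃ F (nabla₂ F h) z = nabla₂ F (nabla₃ F h) z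
        + (invJ F z * _ + b z * _ + -1 * _)
      linarith
    · change nabla₃ F (nabla₃ F h) z = nabla₃ F (nabla₃ F h) z
        + (0 * _ + 0 * _ + 0 * _)
      ring

/-- If each derivative along the frame of `d` is a continuous multiple of `d`, then `d` vanishes
near each of its zeros. -/
theorem HasRegularJets.eventually_eq_zero (hF : HasRegularJets F D) {d : Space → ℝ}
    {μ : Fin 3 → Space → ℝ}
    {z₀ : Space} (hz₀ : z₀ ∈ D) (hμ : ∀ l, ContinuousAt (μ l) z₀)
    (hd : ∀ᶠ z in 𝓝 z₀, ∀ l, HasDirDeriv d z (frame F l z) (μ l z * d z)) (h0 : d z₀ = 0) :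
    ∀ᶠ z in 𝓝 z₀, d z = 0 := by
  have hn := hF.isOpen.mem_nhds hz₀
  have ca : ∀ {h : Space → ℝ}, ContDiffOn ℝ ∞ h D → ContinuousAt h z₀ := fun hh =>
    hh.continuousOn.continuousAt hn
  have cf : ∀ l i, ContinuousAt (fun z => frame F l z i) z₀ := fun l i =>
    ca (contDiffOn_pi.1 (hF.contDiffOn_frame l) i)
  have nf : ∀ z ∈ D, frame F 1 z 2 ≠ 0 ∧ frame F 0 z 1 ≠ 0 ∧ frame F 2 z 0 ≠ 0 := fun z hz =>
    ⟨div_ne_zero (hF.ne_zero z hz) (hF.d_ne_zero z hz),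
      div_ne_zero (hF.denom_ne_zero z hz) (hF.d_ne_zero z hz), hF.ne_zero z hz⟩
  obtain ⟨n2, n1, n0⟩ := nf z₀ hz₀
  -- The frame is triangular: `∇₂` yields the `u₁`-derivative of `d`, then `∇₁` the `u`-derivative,
  -- then `∇₃` the `x`-derivative. The `ν`s are the resulting factors in front of `d`.
  set ν₂ : Space → ℝ := fun z => μ 1 z / frame F 1 z 2
  set ν₁ : Space → ℝ := fun z => (μ 0 z - frame F 0 z 2 * ν₂ z) / frame F 0 z 1
  set ν₀ : Space → ℝ := fun z =>
    (μ 2 z - frame F 2 z 1 * ν₁ z - frame F 2 z 2 * ν₂ z) / frame F 2 z 0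
  have c2 : ContinuousAt ν₂ z₀ := (hμ 1).div (cf 1 2) n2
  have c1 : ContinuousAt ν₁ z₀ := ((hμ 0).sub ((cf 0 2).mul c2)).div (cf 0 1) n1
  have c0 : ContinuousAt ν₀ z₀ :=
    (((hμ 2).sub ((cf 2 1).mul c1)).sub ((cf 2 2).mul c2)).div (cf 2 0) n0
  have hsum : ContinuousAt (fun z => |ν₀ z| + |ν₁ z| + |ν₂ z|) z₀ :=
    (c0.abs.add c1.abs).add c2.abs
  -- The summand `1` leaves room to bound the continuous factors by a constant near `z₀`.
  refine eventually_eq_zero_of_norm_fderiv_le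
    (C := |ν₀ z₀| + |ν₁ z₀| + |ν₂ z₀| + 1) ?_ h0
  filter_upwards [hd, hn, hsum.eventually_lt continuousAt_const (lt_add_one _)] with z hz hzD hb
  obtain ⟨m2, m1, m0⟩ := nf z hzD
  refine ⟨(hz 0).1, ContinuousLinearMap.opNorm_le_bound _ (by positivity) fun v => ?_⟩
  have e2 : pd 2 d z = ν₂ z * d z := by
    have h := (hz 1).2
    have f0 : frame F 1 z 0 = 0 := rfl
    have f1 : frame F 1 z 1 = 0 := rfl
    rw [fderiv_apply_eq_pd, f0, f1] at h
    simp only [ν₂]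
    field_simp
    linarith
  have e1 : pd 1 d z = ν₁ z * d z := by
    have h := (hz 0).2
    have f0 : frame F 0 z 0 = 0 := rfl
    rw [fderiv_apply_eq_pd, f0, e2] at h
    simp only [ν₁]
    rw [div_mul_eq_mul_div, eq_div_iff m1]
    linarith
  have e0 : pd 0 d z = ν₀ z * d z := by
    have h := (hz 2).2
    rw [fderiv_apply_eq_pd, e1, e2] at h
    simp only [ν₀]
    rw [div_mul_eq_mul_div, eq_div_iff m0]
    linarith
  have hv : ∀ i, |v i| ≤ ‖v‖ := fun i => norm_le_pi_norm v i
  rw [fderiv_apply_eq_pd, e0, e1, e2, Real.norm_eq_abs]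
  calc |v 0 * (ν₀ z * d z) + v 1 * (ν₁ z * d z) + v 2 * (ν₂ z * d z)|
      ≤ |v 0| * (|ν₀ z| * |d z|) + |v 1| * (|ν₁ z| * |d z|) + |v 2| * (|ν₂ z| * |d z|) := by
        simp only [← abs_mul]
        exact (abs_add_le _ _).trans (add_le_add_left (abs_add_le _ _) _)
    _ ≤ ‖v‖ * (|ν₀ z| * |d z|) + ‖v‖ * (|ν₁ z| * |d z|) + ‖v‖ * (|ν₂ z| * |d z|) := by
        gcongr <;> exact hv _
    _ = (|ν₀ z| + |ν₁ z| + |ν₂ z|) * (|d z| * ‖v‖) := by ring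
    _ ≤ (|ν₀ z₀| + |ν₁ z₀| + |ν₂ z₀| + 1) * (|d z| * ‖v‖) := by gcongr
    _ = _ := by ring

end

/-! ### Charts of `Σ` and the immersion property -/

/-- `g : V → S ∩ W` parametrizes a piece of `S` by its coordinates number `a 0, a 1, a 2`. -/
structure IsChart (S : Set (Fin 14 → ℝ)) (a : Fin 3 → Fin 14) (W : Set (Fin 14 → ℝ))
    (V : Set (Fin 3 → ℝ)) (g : (Fin 3 → ℝ) → (Fin 14 → ℝ)) : Prop where
  index_mem : ∀ i, a i ∈ ({0, 1, 2, 3, 10} : Set (Fin 14))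
  isOpen_left : IsOpen W
  isOpen_right : IsOpen V
  smooth : ContDiffOn ℝ ∞ g V
  image_eq : g '' V = S ∩ W
  apply_index : ∀ v ∈ V, ∀ i, g v (a i) = v i

theorem IsRegular.exists_isChart {F : Space → ℝ} {D : Set Space} (hF : IsRegular F D)
    {s : Fin 14 → ℝ} (hs : s ∈ Sigma F D) :
    ∃ a W V g, s ∈ W ∧ IsChart (Sigma F D) a W V g := by
  obtain ⟨a, ha, W, V, g, hW, hsW, hV, hg, him, hga⟩ := hF.submanifold s hs
  exact ⟨a, W, V, g, hsW, ha, hW, hV, hg, him, hga⟩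

/-- The components number `a 0, a 1, a 2` of `σ_F`. -/
def coordMap (F : Space → ℝ) (a : Fin 3 → Fin 14) (z : Space) : Space := fun k => sigma F z (a k)

/-- The matrix of derivatives of the components number `a 0, a 1, a 2` of `σ_F` along the
frame. -/
def frameJacobian (F : Space → ℝ) (a : Fin 3 → Fin 14) (z : Space) : Matrix (Fin 3) (Fin 3) ℝ :=
  Matrix.of fun i k => frameDeriv i (a k) (sigma F z)

section

variable {F : Space → ℝ} {D : Set Space} {a : Fin 3 → Fin 14} {W : Set (Fin 14 → ℝ)}
  {V : Set (Fin 3 → ℝ)} {g : (Fin 3 → ℝ) → (Fin 14 → ℝ)} {S : Set (Fin 14 → ℝ)}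

theorem IsChart.apply_eq (hc : IsChart S a W V g) {s : Fin 14 → ℝ} (hs : s ∈ S) (hsW : s ∈ W) :
    (fun k => s (a k)) ∈ V ∧ g (fun k => s (a k)) = s := by
  obtain ⟨v, hv, rfl⟩ : s ∈ g '' V := hc.image_eq ▸ ⟨hs, hsW⟩
  have : (fun k => g v (a k)) = v := funext fun k => hc.apply_index v hv k
  rw [this]
  exact ⟨hv, rfl⟩

theorem HasRegularJets.contDiffOn_coordMap (hF : HasRegularJets F D) (a : Fin 3 → Fin 14) :
    ContDiffOn ℝ ∞ (coordMap F a) D :=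
  contDiffOn_pi.2 fun k => contDiffOn_pi.1 hF.contDiffOn_sigma (a k)

theorem HasRegularJets.fderiv_coordMap_apply (hF : HasRegularJets F D) {z : Space} (hz : z ∈ D)
    (v : Space)
    (k : Fin 3) :
    fderiv ℝ (coordMap F a) z v k = fderiv ℝ (fun w => sigma F w (a k)) z v := by
  rw [show coordMap F a = fun w k => sigma F w (a k) from rfl, fderiv_pi fun k =>
    differentiableAt_of_contDiffOn hF.isOpen (contDiffOn_pi.1 hF.contDiffOn_sigma (a k)) hz]
  rfl

theorem HasRegularJets.fderiv_coordMap_frame (hF : HasRegularJets F D) {z : Space} (hz : z ∈ D)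
    (ha : ∀ i, a i ∈ ({0, 1, 2, 3, 10} : Set (Fin 14))) (i k : Fin 3) :
    fderiv ℝ (coordMap F a) z (frame F i z) k = frameJacobian F a z i k := by
  rw [hF.fderiv_coordMap_apply hz, hF.fderiv_sigma_frame hz i (ha k)]
  rfl

/-- The transpose of `frameJacobian` is the Jacobian matrix of `coordMap` times the matrix `E` of
the frame, and `E` is invertible because the frame is triangular with nonvanishing pivots. -/
theorem HasRegularJets.det_frameJacobian_ne_zero_iff (hF : HasRegularJets F D) {z : Space}
    (hz : z ∈ D)
    (ha : ∀ i, a i ∈ ({0, 1, 2, 3, 10} : Set (Fin 14))) :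
    (frameJacobian F a z).det ≠ 0 ↔ (fderiv ℝ (coordMap F a) z).det ≠ 0 := by
  set T := fderiv ℝ (coordMap F a) z
  set E : Matrix (Fin 3) (Fin 3) ℝ := Matrix.of fun r i => frame F i z r
  have hE : E.det ≠ 0 := by
    have : E.det = -(F z * (F z / pd 2 F z) * ((z 2 * pd 2 F z - F z) / pd 2 F z)) * -1 := by
      rw [Matrix.det_fin_three]
      simp [E, frame, field₁, field₂, field₃]
      ring
    rw [this]
    have := hF.ne_zero z hz
    have := hF.d_ne_zero z hz
    have := hF.denom_ne_zero z hz
    simp [*]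
  have h : LinearMap.toMatrix' (T : Space →ₗ[ℝ] Space) * E = (frameJacobian F a z).transpose := by
    ext k i
    rw [Matrix.transpose_apply, ← hF.fderiv_coordMap_frame hz ha i k]
    exact congrFun (LinearMap.toMatrix'_mulVec (T : Space →ₗ[ℝ] Space) (frame F i z)) k
  have h2 := congrArg Matrix.det h
  rw [Matrix.det_mul, LinearMap.det_toMatrix', Matrix.det_transpose] at h2
  rw [← h2]
  exact ⟨left_ne_zero_of_mul, fun h => mul_ne_zero h hE⟩

theorem HasRegularJets.continuousOn_det_frameJacobian (hF : HasRegularJets F D)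
    (a : Fin 3 → Fin 14) :
    ContinuousOn (fun z => (frameJacobian F a z).det) D := by
  have h : ∀ i k, ContinuousOn (fun z => frameJacobian F a z i k) D := fun i k z hz =>
    (ContinuousAt.comp (contDiffAt_frameDeriv i (a k) (s := sigma F z)
      (hF.invJ_ne_zero hz)).continuousAt
      (hF.contDiffOn_sigma.continuousOn.continuousAt (hF.isOpen.mem_nhds hz))).continuousWithinAt
  simp only [Matrix.det_fin_three]
  fun_prop

theorem HasRegularJets.eventually_mem_chart (hF : HasRegularJets F D) (hc : IsChart S a W V g)
    {z : Space} (hz : z ∈ D) (hzW : sigma F z ∈ W) : ∀ᶠ w in 𝓝 z, w ∈ D ∧ sigma F w ∈ W :=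
  (hF.isOpen.eventually_mem hz).and
    ((hF.contDiffOn_sigma.continuousOn.continuousAt (hF.isOpen.mem_nhds hz)).eventually_mem
      (hc.isOpen_left.mem_nhds hzW))

/-- The frame derivatives of the chart coordinates are themselves functions `m` of these
coordinates. Commuting two frame fields and using the chain rule for `m` gives `∇_l M = M A_l + B_l
M`, so `det M` satisfies a homogeneous linear equation along each frame field. -/
theorem HasRegularJets.eventually_det_frameJacobian_eq_zero (hF : HasRegularJets F D)
    (hc : IsChart (Sigma F D) a W V g) {z₀ : Space} (hz₀ : z₀ ∈ D) (hzW : sigma F z₀ ∈ W)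
    (h0 : (frameJacobian F a z₀).det = 0) : ∀ᶠ z in 𝓝 z₀, (frameJacobian F a z).det = 0 := by
  obtain ⟨C, hC, hcomm⟩ := hF.exists_frame_commutator
  set m : Fin 3 → Fin 3 → Space → ℝ := fun i k v => frameDeriv i (a k) (g v)
  have hchart : ∀ z ∈ D, sigma F z ∈ W → coordMap F a z ∈ V ∧ g (coordMap F a z) = sigma F z :=
    fun z hz hzW => hc.apply_eq ⟨z, hz, rfl⟩ hzW
  have hm : ∀ i k, ContDiffOn ℝ ∞ (m i k) V := fun i k v hv => by
    have hgv : g v ∈ Sigma F D ∩ W := hc.image_eq ▸ Set.mem_image_of_mem g hv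
    obtain ⟨z, hz, hzg⟩ := hgv.1
    have h1 : g v 0 ≠ 0 := by rw [← hzg]; exact hF.invJ_ne_zero hz
    exact ((contDiffAt_frameDeriv i (a k) h1).comp v
      (hc.smooth.contDiffAt (hc.isOpen_right.mem_nhds hv))).contDiffWithinAt
  set A : Fin 3 → Space → Matrix (Fin 3) (Fin 3) ℝ := fun l z =>
    Matrix.of fun r k => pd r (m l k) (coordMap F a z)
  set B : Fin 3 → Space → Matrix (Fin 3) (Fin 3) ℝ := fun l z => Matrix.of fun i r => C l i r z
  have hAc : ContinuousAt (coordMap F a) z₀ :=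
    (hF.contDiffOn_coordMap a).continuousOn.continuousAt (hF.isOpen.mem_nhds hz₀)
  refine hF.eventually_eq_zero (μ := fun l z => (A l z).trace + (B l z).trace) hz₀ ?_ ?_ h0
  · intro l
    have hA : ∀ r k, ContinuousAt (fun z => A l z r k) z₀ := fun r k =>
      ((contDiffOn_pd hc.isOpen_right (hm l k) r).continuousOn.continuousAt
        (hc.isOpen_right.mem_nhds (hchart z₀ hz₀ hzW).1)).comp hAc
    have hB : ∀ r k, ContinuousAt (fun z => B l z r k) z₀ := fun r k =>
      (hC l r k).continuousAt (hF.isOpen.mem_nhds hz₀)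
    simp only [Matrix.trace, Matrix.diag_apply, Fin.sum_univ_three]
    fun_prop
  · have hev := hF.eventually_mem_chart hc hz₀ hzW
    filter_upwards [hev, hev.eventually_nhds] with z hz hzn l
    refine hasDirDeriv_det fun i k => ?_
    have hs : ContDiffOn ℝ ∞ (fun w => sigma F w (a k)) D :=
      contDiffOn_pi.1 hF.contDiffOn_sigma (a k)
    have hVz := (hchart z hz.1 hz.2).1
    have hd : ∀ i, DifferentiableAt ℝ (m i k) (coordMap F a z) := fun i =>
      differentiableAt_of_contDiffOn hc.isOpen_right (hm i k) hVz
    have hA' := differentiableAt_of_contDiffOn hF.isOpen (hF.contDiffOn_coordMap a) hz.1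
    -- Two descriptions of the same entry: `e1` as a function of the chart coordinates, for the
    -- chain rule, and `e2` as a frame derivative of a component of `σ`, for the commutation.
    have e1 : ∀ i, (fun w => frameJacobian F a w i k) =ᶠ[𝓝 z]
        fun w => m i k (coordMap F a w) := fun i =>
      hzn.mono fun w hw => by
        simp only [m, (hchart w hw.1 hw.2).2]
        rfl
    have e2 : ∀ i, (fun w => frameJacobian F a w i k) =ᶠ[𝓝 z]
        fun w => fderiv ℝ (fun w => sigma F w (a k)) w (frame F i w) := fun i =>
      hzn.mono fun w hw => (hF.fderiv_sigma_frame hw.1 i (hc.index_mem k)).symm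
    have e3 : ∀ i v, fderiv ℝ (fun w => frameJacobian F a w i k) z v
        = fderiv ℝ (m i k) (coordMap F a z) (fderiv ℝ (coordMap F a) z v) := fun i v => by
      rw [(e1 i).fderiv_eq]
      exact congrArg (fun T => T v) (fderiv_comp (g := m i k) z (hd i) hA')
    refine ⟨((hd i).comp z hA').congr_of_eventuallyEq (e1 i), ?_⟩
    rw [(e2 i).fderiv_eq, hcomm _ hs z hz.1 l i, ← (e2 l).fderiv_eq, e3, fderiv_apply_eq_pd]
    simp only [hF.fderiv_coordMap_frame hz.1 hc.index_mem,
      hF.fderiv_sigma_frame hz.1 _ (hc.index_mem k)]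
    simp only [Matrix.add_apply, Matrix.mul_apply, Fin.sum_univ_three]
    rfl

/-- Near `z`, `σ = g ∘ coordMap`, while `coordMap` consists of components of `σ`; so the two
derivatives have the same kernel. The left side is independent of the chart, which allows a
connectedness argument over all of `D`. -/
theorem HasRegularJets.fderiv_sigma_injective_iff (hF : HasRegularJets F D)
    (hc : IsChart (Sigma F D) a W V g) {z : Space} (hz : z ∈ D) (hzW : sigma F z ∈ W) :
    Function.Injective (fderiv ℝ (sigma F) z) ↔ (frameJacobian F a z).det ≠ 0 := by
  rw [hF.det_frameJacobian_ne_zero_iff hz hc.index_mem]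
  have hchart : ∀ z ∈ D, sigma F z ∈ W → coordMap F a z ∈ V ∧ g (coordMap F a z) = sigma F z :=
    fun z hz hzW => hc.apply_eq ⟨z, hz, rfl⟩ hzW
  have hA := differentiableAt_of_contDiffOn hF.isOpen (hF.contDiffOn_coordMap a) hz
  have hg : DifferentiableAt ℝ g (coordMap F a z) :=
    differentiableAt_of_contDiffOn hc.isOpen_right hc.smooth (hchart z hz hzW).1
  have e1 : fderiv ℝ (sigma F) z
      = (fderiv ℝ g (coordMap F a z)).comp (fderiv ℝ (coordMap F a) z) := by
    rw [← fderiv_comp z hg hA]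
    refine Filter.EventuallyEq.fderiv_eq ?_
    filter_upwards [hF.eventually_mem_chart hc hz hzW] with w hw
    exact (hchart w hw.1 hw.2).2.symm
  have e2 : ∀ v k, fderiv ℝ (coordMap F a) z v k = fderiv ℝ (sigma F) z v (a k) := fun v k => by
    rw [hF.fderiv_coordMap_apply hz,
      fderiv_apply (differentiableAt_of_contDiffOn hF.isOpen hF.contDiffOn_sigma hz) (a k)]
    rfl
  constructor
  · intro hi hdet
    have hker := LinearMap.bot_lt_ker_of_det_eq_zero hdet
    refine hker.ne' (LinearMap.ker_eq_bot.2 fun v w hvw => hi ?_)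
    rw [e1]
    exact congrArg (fderiv ℝ g (coordMap F a z)) hvw
  · intro hdet v w hvw
    have hT := (ContinuousLinearMap.toContinuousLinearEquivOfDetNeZero _ hdet).injective
    refine hT ?_
    simp only [ContinuousLinearMap.toContinuousLinearEquivOfDetNeZero_apply]
    ext k
    rw [e2, e2, hvw]

/-- The map `σ_F` of a regular system is an immersion. -/
theorem IsRegular.fderiv_sigma_injective (hF : IsRegular F D) {z : Space} (hz : z ∈ D) :
    Function.Injective (fderiv ℝ (sigma F) z) := by
  have hR := hF.hasRegularJets
  -- In charts `P` is open by continuity of the determinant and `Q` because the determinant vanishes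
  -- near its zeros, so one of them is all of `D`.
  set P : Set Space := {z | z ∈ D ∧ Function.Injective (fderiv ℝ (sigma F) z)}
  set Q : Set Space := {z | z ∈ D ∧ ¬ Function.Injective (fderiv ℝ (sigma F) z)}
  have hchart := fun {z : Space} (hz : z ∈ D) =>
    hF.exists_isChart (s := sigma F z) ⟨z, hz, rfl⟩
  have hP : IsOpen P := isOpen_iff_mem_nhds.2 fun z hz => by
    obtain ⟨a, W, V, g, hzW, hc⟩ := hchart hz.1
    have h0 := (hR.fderiv_sigma_injective_iff hc hz.1 hzW).1 hz.2
    filter_upwards [hR.eventually_mem_chart hc hz.1 hzW,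
      ((hR.continuousOn_det_frameJacobian a).continuousAt
        (hR.isOpen.mem_nhds hz.1)).eventually_ne h0] with w hw hw0
    exact ⟨hw.1, (hR.fderiv_sigma_injective_iff hc hw.1 hw.2).2 hw0⟩
  have hQ : IsOpen Q := isOpen_iff_mem_nhds.2 fun z hz => by
    obtain ⟨a, W, V, g, hzW, hc⟩ := hchart hz.1
    have h0 := not_not.1 (mt (hR.fderiv_sigma_injective_iff hc hz.1 hzW).2 hz.2)
    filter_upwards [hR.eventually_mem_chart hc hz.1 hzW,
      hR.eventually_det_frameJacobian_eq_zero hc hz.1 hzW h0] with w hw hw0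
    exact ⟨hw.1, fun h => (hR.fderiv_sigma_injective_iff hc hw.1 hw.2).1 h hw0⟩
  have hPQ : Disjoint P Q := Set.disjoint_left.2 fun z h1 h2 => h2.2 h1.2
  rcases hF.isConnected.isPreconnected.subset_or_subset hP hQ hPQ
    (fun z hz => (em _).imp (fun h => ⟨hz, h⟩) fun h => ⟨hz, h⟩) with h | h
  · exact (h hz).2
  exfalso
  obtain ⟨a, W, V, g, hzW, hc⟩ := hchart hz
  -- If `σ` were nowhere an immersion, `V` would consist of critical values of `coordMap` and be
  -- null by Sard's theorem, though it is open and nonempty.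
  have hV : V ⊆ coordMap F a '' {w | w ∈ D ∧ sigma F w ∈ W} := fun v hv => by
    have hgv : g v ∈ Sigma F D ∩ W := hc.image_eq ▸ Set.mem_image_of_mem g hv
    obtain ⟨w, hw, hwg⟩ := hgv.1
    refine ⟨w, ⟨hw, hwg ▸ hgv.2⟩, funext fun k => ?_⟩
    rw [← hc.apply_index v hv k, ← hwg]
    rfl
  have h0 : MeasureTheory.volume V = 0 := by
    refine MeasureTheory.measure_mono_null hV
      (MeasureTheory.addHaar_image_eq_zero_of_det_fderivWithin_eq_zero MeasureTheory.volume
        (f' := fderiv ℝ (coordMap F a)) (fun w hw => ?_) fun w hw => ?_)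
    · exact (differentiableAt_of_contDiffOn hR.isOpen
        (hR.contDiffOn_coordMap a) hw.1).hasFDerivAt.hasFDerivWithinAt
    · have h1 := mt (hR.fderiv_sigma_injective_iff hc hw.1 hw.2).2 (h hw.1).2
      rw [hR.det_frameJacobian_ne_zero_iff hw.1 hc.index_mem] at h1
      exact not_not.1 h1
  exact (hc.isOpen_right.measure_pos MeasureTheory.volume
    ⟨_, (hc.apply_eq ⟨z, hz, rfl⟩ hzW).1⟩).ne' h0

theorem IsRegular.det_fderiv_coordMap_ne_zero (hF : IsRegular F D)
    (hc : IsChart (Sigma F D) a W V g) {z : Space} (hz : z ∈ D) (hzW : sigma F z ∈ W) :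
    (fderiv ℝ (coordMap F a) z).det ≠ 0 :=
  (hF.hasRegularJets.det_frameJacobian_ne_zero_iff hz hc.index_mem).1
    ((hF.hasRegularJets.fderiv_sigma_injective_iff hc hz hzW).1 (hF.fderiv_sigma_injective hz))

end

/-! ### Invariance under feedback transformations -/

/-- On the open set `N`, the map `(a, b, c)` is the prolongation, restricted to the system `F`, of
a feedback transformation that carries `F` to the system `G` on `D'`. -/
structure IsProlongation (F : Space → ℝ) (N : Set Space) (G : Space → ℝ) (D' : Set Space)
    (a b c : Space → ℝ) : Prop where
  smooth_a : ContDiffOn ℝ ∞ a N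
  smooth_b : ContDiffOn ℝ ∞ b N
  smooth_c : ContDiffOn ℝ ∞ c N
  pd_one_a : ∀ z ∈ N, pd 1 a z = 0
  pd_two_a : ∀ z ∈ N, pd 2 a z = 0
  pd_two_b : ∀ z ∈ N, pd 2 b z = 0
  c_eq : ∀ z ∈ N, c z = pd 0 b z * F z + pd 1 b z * z 2
  pd_zero_a_ne_zero : ∀ z ∈ N, pd 0 a z ≠ 0
  pd_one_b_ne_zero : ∀ z ∈ N, pd 1 b z ≠ 0
  maps : ∀ z ∈ N, ![a z, b z, c z] ∈ D'
  system : ∀ z ∈ N, pd 0 a z * F z = G ![a z, b z, c z]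

theorem hasDirDeriv_comp {a b c H : Space → ℝ} {z v : Space} {a' b' c' : ℝ}
    (ha : HasDirDeriv a z v a') (hb : HasDirDeriv b z v b') (hc : HasDirDeriv c z v c')
    (hH : DifferentiableAt ℝ H ![a z, b z, c z]) :
    HasDirDeriv (fun w => H ![a w, b w, c w]) z v (fderiv ℝ H ![a z, b z, c z] ![a', b', c']) := by
  have hψ : HasFDerivAt (fun w => ![a w, b w, c w])
      (ContinuousLinearMap.pi ![fderiv ℝ a z, fderiv ℝ b z, fderiv ℝ c z]) z := by
    refine hasFDerivAt_pi.2 fun i => ?_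
    fin_cases i
    exacts [ha.1.hasFDerivAt, hb.1.hasFDerivAt, hc.1.hasFDerivAt]
  have h : HasFDerivAt (fun w => H ![a w, b w, c w]) _ z := hH.hasFDerivAt.comp z hψ
  refine ⟨h.differentiableAt, ?_⟩
  rw [h.fderiv]
  refine congrArg (fderiv ℝ H ![a z, b z, c z]) ?_
  ext i
  fin_cases i
  exacts [ha.2, hb.2, hc.2]

section

variable {F G : Space → ℝ} {N D' : Set Space} {a b c : Space → ℝ}

theorem IsProlongation.hasDirDeriv_comp (hp : IsProlongation F N G D' a b c)
    (hF : HasRegularJets F N) {H : Space → ℝ} {z : Space} (hz : z ∈ N)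
    (hH : DifferentiableAt ℝ H ![a z, b z, c z]) (v : Space) :
    HasDirDeriv (fun w => H ![a w, b w, c w]) z v
      (fderiv ℝ H ![a z, b z, c z] ![fderiv ℝ a z v, fderiv ℝ b z v, fderiv ℝ c z v]) :=
  FeedbackControl.hasDirDeriv_comp
    ⟨differentiableAt_of_contDiffOn hF.isOpen hp.smooth_a hz, rfl⟩
    ⟨differentiableAt_of_contDiffOn hF.isOpen hp.smooth_b hz, rfl⟩
    ⟨differentiableAt_of_contDiffOn hF.isOpen hp.smooth_c hz, rfl⟩ hH

/-- The first and second order partial derivatives of `F` and `G` are related by the derivatives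
of the transformation. -/
theorem IsProlongation.pd_relations (hp : IsProlongation F N G D' a b c)
    (hF : HasRegularJets F N) (hG : HasRegularJets G D') {z : Space} (hz : z ∈ N) :
    let q := ![a z, b z, c z]
    let P := pd 0 b z * pd 2 F z + pd 1 b z
    pd 2 c z = P ∧
    pd 0 c z = pd 0 (pd 0 b) z * F z + pd 0 b z * pd 0 F z + pd 0 (pd 1 b) z * z 2 ∧
    pd 1 c z = pd 0 (pd 1 b) z * F z + pd 0 b z * pd 1 F z + pd 1 (pd 1 b) z * z 2 ∧
    G q = pd 0 a z * F z ∧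
    pd 2 G q * P = pd 0 a z * pd 2 F z ∧
    pd 1 G q * pd 1 b z + pd 2 G q * pd 1 c z = pd 0 a z * pd 1 F z ∧
    pd 0 G q * pd 0 a z + pd 1 G q * pd 0 b z + pd 2 G q * pd 0 c z
      = pd 0 (pd 0 a) z * F z + pd 0 a z * pd 0 F z ∧
    pd 2 (pd 2 G) q * P * P + pd 2 G q * (pd 0 b z * pd 2 (pd 2 F) z)
      = pd 0 a z * pd 2 (pd 2 F) z ∧
    (pd 1 (pd 2 G) q * pd 1 b z + pd 2 (pd 2 G) q * pd 1 c z) * P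
      + pd 2 G q * (pd 0 (pd 1 b) z * pd 2 F z + pd 0 b z * pd 1 (pd 2 F) z + pd 1 (pd 1 b) z)
      = pd 0 a z * pd 1 (pd 2 F) z ∧
    (pd 0 (pd 2 G) q * pd 0 a z + pd 1 (pd 2 G) q * pd 0 b z + pd 2 (pd 2 G) q * pd 0 c z) * P
      + pd 2 G q * (pd 0 (pd 0 b) z * pd 2 F z + pd 0 b z * pd 0 (pd 2 F) z + pd 0 (pd 1 b) z)
      = pd 0 (pd 0 a) z * pd 2 F z + pd 0 a z * pd 0 (pd 2 F) z := by
  intro q P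
  have hN := hF.isOpen
  have hq := hp.maps z hz
  have sp := fun {h : Space → ℝ} (hh : ContDiffOn ℝ ∞ h N) i => contDiffOn_pd hN hh i
  have dd := fun {h : Space → ℝ} (hh : ContDiffOn ℝ ∞ h N) {w : Space} (hw : w ∈ N) v =>
    hasDirDeriv_of_differentiableAt (differentiableAt_of_contDiffOn hN hh hw) v
  have zero : ∀ {h : Space → ℝ}, (∀ w ∈ N, h w = 0) → ∀ w ∈ N, ∀ i, pd i h w = 0 :=
    fun {h} hh w hw i => by
      rw [pd, fderiv_eq_of_eqOn hN (h' := fun _ => 0) hh hw]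
      simp
  have a01 : ∀ w ∈ N, pd 1 (pd 0 a) w = 0 := fun w hw =>
    (pd_comm hN hp.smooth_a hw 1 0).trans (zero hp.pd_one_a w hw 0)
  have a02 : ∀ w ∈ N, pd 2 (pd 0 a) w = 0 := fun w hw =>
    (pd_comm hN hp.smooth_a hw 2 0).trans (zero hp.pd_two_a w hw 0)
  have b02 : ∀ w ∈ N, ∀ i, pd 2 (pd i b) w = 0 := fun w hw i =>
    (pd_comm hN hp.smooth_b hw 2 i).trans (zero hp.pd_two_b w hw i)
  have b10 : pd 1 (pd 0 b) z = pd 0 (pd 1 b) z := pd_comm hN hp.smooth_b hz 1 0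
  have dc : ∀ w ∈ N, ∀ v, fderiv ℝ c w v = _ := fun w hw v =>
    (congrArg (fun T => T v) (fderiv_eq_of_eqOn hN hp.c_eq hw)).trans
      (((dd (sp hp.smooth_b 0) hw v).mul (dd hF.smooth hw v)).add
        ((dd (sp hp.smooth_b 1) hw v).mul (HasDirDeriv.coord 2 w v))).2
  have c2 : ∀ w ∈ N, pd 2 c w = pd 0 b w * pd 2 F w + pd 1 b w := fun w hw => by
    rw [pd, dc w hw]
    simp [b02 w hw]
  have c0 : pd 0 c z
      = pd 0 (pd 0 b) z * F z + pd 0 b z * pd 0 F z + pd 0 (pd 1 b) z * z 2 := by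
    rw [pd, dc z hz]
    simp
  have c1 : pd 1 c z
      = pd 0 (pd 1 b) z * F z + pd 0 b z * pd 1 F z + pd 1 (pd 1 b) z * z 2 := by
    rw [pd, dc z hz]
    simp [b10]
  have ez : ∀ (i : Fin 3) (h : Space → ℝ) (w : Space),
      fderiv ℝ h w (Pi.single i 1) = pd i h w := fun _ _ _ => rfl
  have dG : ∀ {H : Space → ℝ}, ContDiffOn ℝ ∞ H D' → ∀ w ∈ N, ∀ i,
      fderiv ℝ (fun w => H ![a w, b w, c w]) w (Pi.single i 1)
        = pd i a w * pd 0 H ![a w, b w, c w] + pd i b w * pd 1 H ![a w, b w, c w]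
          + pd i c w * pd 2 H ![a w, b w, c w] := fun {H} hH w hw i => by
    refine (hp.hasDirDeriv_comp hF hw
      (differentiableAt_of_contDiffOn hG.isOpen hH (hp.maps w hw)) _).2.trans ?_
    rw [fderiv_apply_eq_pd]
    rfl
  -- `r1` is the gradient of `X_x F = G(X, U, c)`. Only its `u₁`-component `r2` is differentiated
  -- again, since `J` and the frame contain no second derivatives other than those of `F_{u₁}`.
  have r1 : ∀ w ∈ N, ∀ i, pd i a w * pd 0 G ![a w, b w, c w] + pd i b w * pd 1 G ![a w, b w, c w]
      + pd i c w * pd 2 G ![a w, b w, c w] = pd i (pd 0 a) w * F w + pd 0 a w * pd i F w :=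
    fun w hw i => by
      rw [← dG hG.smooth w hw i, ← fderiv_eq_of_eqOn hN hp.system hw]
      exact (HasDirDeriv.mul ⟨(dd (sp hp.smooth_a 0) hw 0).1, rfl⟩
        ⟨(dd hF.smooth hw 0).1, rfl⟩).2
  have r2 : ∀ w ∈ N, pd 2 G ![a w, b w, c w] * (pd 0 b w * pd 2 F w + pd 1 b w)
      = pd 0 a w * pd 2 F w := fun w hw => by
    have := r1 w hw 2
    rw [hp.pd_two_a w hw, hp.pd_two_b w hw, a02 w hw, c2 w hw] at this
    linarith
  have hG2 := contDiffOn_pd hG.isOpen hG.smooth 2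
  have r3 : ∀ i, (pd i a z * pd 0 (pd 2 G) q + pd i b z * pd 1 (pd 2 G) q
      + pd i c z * pd 2 (pd 2 G) q) * P + pd 2 G q *
        (pd i (pd 0 b) z * pd 2 F z + pd 0 b z * pd i (pd 2 F) z + pd i (pd 1 b) z)
      = pd i (pd 0 a) z * pd 2 F z + pd 0 a z * pd i (pd 2 F) z := fun i => by
    have dF2 := (dd (sp hF.smooth 2) hz 0).1
    have e1 := (HasDirDeriv.mul (v := Pi.single i 1) ⟨(dd (sp hp.smooth_a 0) hz 0).1, rfl⟩
      ⟨dF2, rfl⟩).2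
    have e2 := (HasDirDeriv.mul ((hp.hasDirDeriv_comp hF hz
      (differentiableAt_of_contDiffOn hG.isOpen hG2 hq) (Pi.single i 1)))
      ((HasDirDeriv.mul ⟨(dd (sp hp.smooth_b 0) hz 0).1, rfl⟩ ⟨dF2, rfl⟩).add
        ⟨(dd (sp hp.smooth_b 1) hz 0).1, rfl⟩)).2
    rw [fderiv_eq_of_eqOn hN r2 hz, e1, fderiv_apply_eq_pd (pd 2 G)] at e2
    simp only [ez] at e2
    exact e2.symm
  refine ⟨c2 z hz, c0, c1, (hp.system z hz).symm, r2 z hz, ?_, ?_, ?_, ?_, ?_⟩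
  · have := r1 z hz 1
    rw [hp.pd_one_a z hz, a01 z hz] at this
    linarith
  · have := r1 z hz 0
    linarith
  · have := r3 2
    rw [hp.pd_two_a z hz, hp.pd_two_b z hz, a02 z hz, c2 z hz, b02 z hz, b02 z hz] at this
    linarith
  · have := r3 1
    rw [hp.pd_one_a z hz, a01 z hz, b10] at this
    linarith
  · have := r3 0
    linarith

end

section

variable {F G : Space → ℝ} {N D' : Set Space} {a b c : Space → ℝ}

/-- The factor `P` is the `u₁`-derivative of the new third coordinate; `G_{u₁} P = X_x F_{u₁}` shows
that it is nonzero. Each ingredient of `J` thus only acquires a factor made of `X_x`, `U_u` and `P`.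
-/
theorem IsProlongation.jet_relations (hp : IsProlongation F N G D' a b c)
    (hF : HasRegularJets F N) (hG : HasRegularJets G D') {z : Space} (hz : z ∈ N) :
    let q := ![a z, b z, c z]
    let P := pd 0 b z * pd 2 F z + pd 1 b z
    P ≠ 0 ∧ pd 2 G q = pd 0 a z * pd 2 F z / P ∧
    c z * pd 2 G q - G q = pd 0 a z * pd 1 b z * (z 2 * pd 2 F z - F z) / P ∧
    pd 2 (pd 2 G) q = pd 0 a z * pd 2 (pd 2 F) z * pd 1 b z / P ^ 3 := by
  intro q P
  obtain ⟨-, -, -, hG0, r2, -, -, r22, -, -⟩ := hp.pd_relations hF hG hz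
  have na := hp.pd_zero_a_ne_zero z hz
  have n2 := hF.d_ne_zero z hz
  have nP : P ≠ 0 := right_ne_zero_of_mul (r2 ▸ mul_ne_zero na n2)
  have e2 : pd 2 G q = pd 0 a z * pd 2 F z / P := by rw [eq_div_iff nP]; exact r2
  refine ⟨nP, e2, ?_, ?_⟩
  · rw [e2, hp.c_eq z hz, show G q = _ from hG0]
    field_simp
    simp only [P]
    ring
  · change pd 2 (pd 2 G) q * P * P + pd 2 G q * _ = _ at r22
    rw [e2] at r22
    rw [eq_div_iff (pow_ne_zero 3 nP)]
    field_simp at r22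
    linear_combination r22

/-- Numerator and denominator both acquire the factor `X_x³ U_u / P³`. -/
theorem IsProlongation.invJ_eq (hp : IsProlongation F N G D' a b c) (hF : HasRegularJets F N)
    (hG : HasRegularJets G D') {z : Space} (hz : z ∈ N) :
    invJ G ![a z, b z, c z] = invJ F z := by
  obtain ⟨nP, e2, ed, e22⟩ := hp.jet_relations hF hG hz
  have na := hp.pd_zero_a_ne_zero z hz
  have nb := hp.pd_one_b_ne_zero z hz
  have n2 := hF.d_ne_zero z hz
  have nd := hF.denom_ne_zero z hz
  rw [invJ, invJ]
  change G _ ^ 2 * _ / ((c z * _ - G _) * _) = _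
  rw [ed, e22, e2, ← hp.system z hz]
  generalize z 2 * pd 2 F z - F z = d at *
  generalize pd 0 b z * pd 2 F z + pd 1 b z = P at *
  field_simp

/-- The prolongation of a feedback transformation carries the frame of `F` to the frame of `G`. -/
theorem IsProlongation.fderiv_frame (hp : IsProlongation F N G D' a b c)
    (hF : HasRegularJets F N) (hG : HasRegularJets G D') {z : Space} (hz : z ∈ N) (i : Fin 3) :
    ![fderiv ℝ a z (frame F i z), fderiv ℝ b z (frame F i z), fderiv ℝ c z (frame F i z)]
      = frame G i ![a z, b z, c z] := by
  obtain ⟨nP, e2, ed, e22⟩ := hp.jet_relations hF hG hz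
  obtain ⟨c2, c0, c1, hG0, r2, r1, r0, r22, r12, r02⟩ := hp.pd_relations hF hG hz
  have na := hp.pd_zero_a_ne_zero z hz
  have nb := hp.pd_one_b_ne_zero z hz
  have n2 := hF.d_ne_zero z hz
  have n22 := hF.dd_ne_zero z hz
  have a1 := hp.pd_one_a z hz
  have a2 := hp.pd_two_a z hz
  have b2 := hp.pd_two_b z hz
  have hc := hp.c_eq z hz
  have m2 := hG.d_ne_zero _ (hp.maps z hz)
  have m22 := hG.dd_ne_zero _ (hp.maps z hz)
  have w1 : pd 1 c z * ((z 2 * pd 2 F z - F z) / pd 2 F z)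
      + pd 2 c z * ((F z - z 2 * pd 2 F z) / pd 2 F z ^ 2 * pd 1 F z)
      = (G ![a z, b z, c z] - c z * pd 2 G ![a z, b z, c z]) / pd 2 G ![a z, b z, c z] ^ 2
        * pd 1 G ![a z, b z, c z] := by
    have g1 : pd 1 G ![a z, b z, c z]
        = (pd 0 a z * pd 1 F z - pd 2 G ![a z, b z, c z] * pd 1 c z) / pd 1 b z := by
      rw [eq_div_iff nb]
      linarith
    rw [← neg_sub (c z * _), ed, g1, e2, c2]
    generalize pd 0 b z * pd 2 F z + pd 1 b z = P at *
    field_simp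
    ring
  -- This is the `u₁`-component for `∇₁ + ∇₃`, in which the terms with the factor `(u₁F_{u₁} -
  -- F)/F_{u₁}²` cancel, leaving the field `(F, u₁, B)`. The combination below differentiates `r2`
  -- along that field.
  have w3 : pd 0 c z * F z + pd 1 c z * z 2 + pd 2 c z *
      ((pd 0 F z * pd 2 F z + pd 1 F z - z 2 * pd 1 (pd 2 F) z - F z * pd 0 (pd 2 F) z)
        / pd 2 (pd 2 F) z)
      = (pd 0 G ![a z, b z, c z] * pd 2 G ![a z, b z, c z] + pd 1 G ![a z, b z, c z]
        - c z * pd 1 (pd 2 G) ![a z, b z, c z]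
        - G ![a z, b z, c z] * pd 0 (pd 2 G) ![a z, b z, c z])
        / pd 2 (pd 2 G) ![a z, b z, c z] := by
    rw [eq_div_iff m22, c2]
    have hB := div_mul_cancel₀
      (pd 0 F z * pd 2 F z + pd 1 F z - z 2 * pd 1 (pd 2 F) z - F z * pd 0 (pd 2 F) z) n22
    generalize (pd 0 F z * pd 2 F z + pd 1 F z - z 2 * pd 1 (pd 2 F) z
      - F z * pd 0 (pd 2 F) z) / pd 2 (pd 2 F) z = B at *
    refine mul_left_cancel₀ nP ?_
    linear_combination F z * r02 + z 2 * r12 + B * r22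
      + (pd 0 a z - pd 2 G ![a z, b z, c z] * pd 0 b z) * hB - pd 0 G ![a z, b z, c z] * r2
      - pd 2 F z * r0 - r1
      + (pd 0 b z * pd 2 F z + pd 1 b z) * (pd 1 (pd 2 G) ![a z, b z, c z] * hc
        + pd 0 (pd 2 G) ![a z, b z, c z] * hG0)
      + pd 2 G ![a z, b z, c z] * pd 2 F z * c0 + pd 2 G ![a z, b z, c z] * c1
  fin_cases i
  · change ![fderiv ℝ a z (field₁ F z), fderiv ℝ b z (field₁ F z), fderiv ℝ c z (field₁ F z)]
      = field₁ G _
    ext k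
    fin_cases k
    · simp [fderiv_apply_eq_pd, field₁, a1, a2]
    · simp only [fderiv_apply_eq_pd, field₁, b2]
      change 0 * _ + _ + _ = (c z * _ - G _) / _
      rw [ed, e2]
      generalize pd 0 b z * pd 2 F z + pd 1 b z = P at *
      simp only [Matrix.cons_val_one, Matrix.cons_val_zero, Matrix.cons_val]
      field_simp
      ring
    · change fderiv ℝ c z (field₁ F z) = _
      simp only [fderiv_apply_eq_pd, field₁]
      refine Eq.trans ?_ w1
      simp only [Matrix.cons_val_one, Matrix.cons_val_zero, Matrix.cons_val]
      ring
  · change ![fderiv ℝ a z (field₂ F z), fderiv ℝ b z (field₂ F z), fderiv ℝ c z (field₂ F z)]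
      = field₂ G _
    ext k
    fin_cases k
    · simp [fderiv_apply_eq_pd, field₂, a2]
    · simp [fderiv_apply_eq_pd, field₂, b2]
    · simp only [fderiv_apply_eq_pd, field₂]
      change 0 * _ + 0 * _ + _ = G _ / _
      rw [hG0, e2, c2]
      simp only [Matrix.cons_val]
      generalize pd 0 b z * pd 2 F z + pd 1 b z = P at *
      field_simp
      ring
  · change ![fderiv ℝ a z (field₃ F z), fderiv ℝ b z (field₃ F z), fderiv ℝ c z (field₃ F z)]
      = field₃ G _
    ext k
    fin_cases k
    · simp only [fderiv_apply_eq_pd, field₃, a1, a2]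
      change F z * _ + _ + _ = G _
      rw [hG0]
      ring
    · simp only [fderiv_apply_eq_pd, field₃, b2]
      change F z * _ + _ + _ = G _ / _
      rw [hG0, e2]
      simp only [Matrix.cons_val_one, Matrix.cons_val_zero, Matrix.cons_val]
      field_simp
      ring
    · simp only [fderiv_apply_eq_pd, field₃]
      change F z * _ + _ + _ = _ / _ + (c z * _ - G _) / _ * _
      simp only [Matrix.cons_val_one, Matrix.cons_val_zero, Matrix.cons_val]
      rw [← w3, ← neg_sub (G _), neg_div, neg_mul, ← w1]
      field_simp
      ring

theorem IsProlongation.fderiv_comp_frame (hp : IsProlongation F N G D' a b c)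
    (hF : HasRegularJets F N) (hG : HasRegularJets G D') {H : Space → ℝ}
    (hH : ContDiffOn ℝ ∞ H D') {z : Space} (hz : z ∈ N) (i : Fin 3) :
    fderiv ℝ (fun w => H ![a w, b w, c w]) z (frame F i z)
      = fderiv ℝ H ![a z, b z, c z] (frame G i ![a z, b z, c z]) := by
  rw [(hp.hasDirDeriv_comp hF hz
    (differentiableAt_of_contDiffOn hG.isOpen hH (hp.maps z hz)) _).2, hp.fderiv_frame hF hG hz]

/-- Functions that agree after pulling back have derivatives along the frames that agree. -/
theorem IsProlongation.fderiv_frame_eq (hp : IsProlongation F N G D' a b c)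
    (hF : HasRegularJets F N) (hG : HasRegularJets G D') {h H : Space → ℝ}
    (hH : ContDiffOn ℝ ∞ H D') (hh : ∀ w ∈ N, H ![a w, b w, c w] = h w) (i : Fin 3) :
    ∀ w ∈ N, fderiv ℝ H ![a w, b w, c w] (frame G i ![a w, b w, c w])
      = fderiv ℝ h w (frame F i w) := fun w hw => by
  rw [← hp.fderiv_comp_frame hF hG hH hw i, fderiv_eq_of_eqOn hF.isOpen hh hw]

/-- `K` is read off on the coordinate `u₁` of the target, whose pullback is `c`. The relation `[∇₃,
∇₁] = K ∇₂` is therefore needed on `F` for the function `c`, not just for `u₁`. -/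
theorem IsProlongation.invK_eq (hp : IsProlongation F N G D' a b c) (hF : HasRegularJets F N)
    (hG : HasRegularJets G D') : ∀ w ∈ N, invK G ![a w, b w, c w] = invK F w := by
  intro z hz
  have hc2 := contDiffOn_coord (D := D') 2
  have e0 : ∀ w ∈ N, (fun y : Space => y 2) ![a w, b w, c w] = c w := fun w _ => rfl
  have e1 := hp.fderiv_frame_eq hF hG hc2 e0 0
  have e2 := hp.fderiv_frame_eq hF hG hc2 e0 1
  have e3 := hp.fderiv_frame_eq hF hG hc2 e0 2
  have e31 := hp.fderiv_frame_eq hF hG (hG.contDiffOn_nabla₁ hc2) e1 2 z hz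
  have e13 := hp.fderiv_frame_eq hF hG (hG.contDiffOn_nabla₃ hc2) e3 0 z hz
  have n2 : nabla₂ G (fun w => w 2) ![a z, b z, c z] ≠ 0 := by
    rw [nabla₂_coord_two]
    exact div_ne_zero (hG.ne_zero _ (hp.maps z hz)) (hG.d_ne_zero _ (hp.maps z hz))
  rw [invK, div_eq_iff n2]
  have e2z : nabla₂ G (fun w => w 2) ![a z, b z, c z] = nabla₂ F c z := e2 z hz
  rw [e2z, ← hF.nabla₃_nabla₁ hp.smooth_c hz]
  exact congrArg₂ (· - ·) e31 e13

/-- The components of `σ` are invariants of feedback transformations. -/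
theorem IsProlongation.sigma_eq (hp : IsProlongation F N G D' a b c) (hF : HasRegularJets F N)
    (hG : HasRegularJets G D') {z : Space} (hz : z ∈ N) :
    sigma G ![a z, b z, c z] = sigma F z := by
  have hJ := hG.contDiffOn_invJ
  have hK := hG.contDiffOn_invK
  have e := fun {h H : Space → ℝ} => hp.fderiv_frame_eq (h := h) (H := H) hF hG
  have eJ : ∀ w ∈ N, invJ G ![a w, b w, c w] = invJ F w := fun w hw => hp.invJ_eq hF hG hw
  have eK := hp.invK_eq hF hG
  have h1 := hG.contDiffOn_nabla₁ hJ
  have h2 := hG.contDiffOn_nabla₂ hJ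
  have h3 := hG.contDiffOn_nabla₃ hJ
  have e1 := e hJ eJ 0
  have e2 := e hJ eJ 1
  have e3 := e hJ eJ 2
  ext i
  fin_cases i
  exacts [eJ z hz, e1 z hz, e2 z hz, e3 z hz, e h1 e1 0 z hz, e h2 e2 0 z hz, e h3 e3 0 z hz,
    e h2 e2 1 z hz, e h3 e3 1 z hz, e h3 e3 2 z hz, eK z hz, e hK eK 0 z hz, e hK eK 1 z hz,
    e hK eK 2 z hz]

end

/-! ### From a local feedback transformation to an `IsProlongation` -/

theorem hasDirDeriv_comp_coord {X : ℝ → ℝ} {z : Space} (hX : DifferentiableAt ℝ X (z 0))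
    (v : Space) : HasDirDeriv (fun z => X (z 0)) z v (v 0 * deriv X (z 0)) := by
  have h : HasFDerivAt (fun z : Space => X (z 0)) (deriv X (z 0) • fderiv ℝ (fun w => w 0) z) z :=
    hX.hasDerivAt.comp_hasFDerivAt (f := fun w : Space => w 0) z
      (HasDirDeriv.coord 0 z 0).1.hasFDerivAt
  refine ⟨h.differentiableAt, ?_⟩
  rw [h.fderiv, smul_apply, (HasDirDeriv.coord 0 z _).2, smul_eq_mul, mul_comm]

theorem hasDirDeriv_comp_coord_prod {U : ℝ × ℝ → ℝ} {z : Space}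
    (hU : DifferentiableAt ℝ U (z 0, z 1)) (v : Space) :
    HasDirDeriv (fun z => U (z 0, z 1)) z v (fderiv ℝ U (z 0, z 1) (v 0, v 1)) := by
  have h : HasFDerivAt (fun z : Space => U (z 0, z 1)) ((fderiv ℝ U (z 0, z 1)).comp
      ((fderiv ℝ (fun w => w 0) z).prod (fderiv ℝ (fun w => w 1) z))) z :=
    hU.hasFDerivAt.comp (f := fun w : Space => (w 0, w 1)) z
      ((HasDirDeriv.coord 0 z 0).1.hasFDerivAt.prodMk (HasDirDeriv.coord 1 z 0).1.hasFDerivAt)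
  refine ⟨h.differentiableAt, ?_⟩
  rw [h.fderiv]
  refine congrArg (fderiv ℝ U (z 0, z 1)) (Prod.ext ?_ ?_)
  exacts [(HasDirDeriv.coord 0 z _).2, (HasDirDeriv.coord 1 z _).2]

/-- A local feedback transformation preserves `σ`. -/
theorem FeedbackEquivalentAt.sigma_eq {F G : Space → ℝ} {D D' : Set Space} {p q : Space}
    (hF : HasRegularJets F D) (hG : HasRegularJets G D') (hp : p ∈ D) (hq : q ∈ D')
    (h : FeedbackEquivalentAt F p G q) : sigma F p = sigma G q := by
  obtain ⟨X, U, hX, hU, hX0, hU0, hpq, hsys⟩ := h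
  have c0 : Continuous fun z : Space => z 0 := continuous_apply 0
  have c01 : Continuous fun z : Space => (z 0, z 1) := c0.prodMk (continuous_apply 1)
  set a : Space → ℝ := fun z => X (z 0)
  set b : Space → ℝ := fun z => U (z 0, z 1)
  set c : Space → ℝ := fun z =>
    fderiv ℝ U (z 0, z 1) (1, 0) * F z + fderiv ℝ U (z 0, z 1) (0, 1) * z 2 with hc
  have hprol : ∀ z, prolong F X U z = ![a z, b z, c z] := fun z => rfl
  have evX : ∀ᶠ z : Space in 𝓝 p, ContDiffAt ℝ ∞ X (z 0) := c0.continuousAt.eventually hX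
  have evU : ∀ᶠ z : Space in 𝓝 p, ContDiffAt ℝ ∞ U (z 0, z 1) := c01.continuousAt.eventually hU
  obtain ⟨N₀, hN₀, hN₀o, hpN₀⟩ := eventually_nhds_iff.1 ((evX.and evU).and
    (hsys.and (hF.isOpen.eventually_mem hp)))
  have p0 : ContDiff ℝ ∞ fun z : Space => z 0 := contDiff_apply ℝ ℝ 0
  have p01 : ContDiff ℝ ∞ fun z : Space => (z 0, z 1) := p0.prodMk (contDiff_apply ℝ ℝ 1)
  have sX' : ContDiffOn ℝ ∞ (fun z : Space => deriv X (z 0)) N₀ := fun z hz => by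
    have h1 : ContDiffAt ℝ ∞ (deriv X) (z 0) := by
      have := (hN₀ z hz).1.1.fderiv_right (m := ∞) (by simp)
      exact this.clm_apply contDiffAt_const
    exact (h1.comp z p0.contDiffAt).contDiffWithinAt
  have sU' : ∀ v, ContDiffOn ℝ ∞ (fun z : Space => fderiv ℝ U (z 0, z 1) v) N₀ := fun v z hz => by
    have h1 := (hN₀ z hz).1.2.fderiv_right (m := ∞) (by simp)
    exact ((h1.clm_apply contDiffAt_const).comp z p01.contDiffAt).contDiffWithinAt
  have sa : ContDiffOn ℝ ∞ a N₀ := fun z hz =>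
    ((hN₀ z hz).1.1.comp z p0.contDiffAt).contDiffWithinAt
  have sb : ContDiffOn ℝ ∞ b N₀ := fun z hz =>
    ((hN₀ z hz).1.2.comp z p01.contDiffAt).contDiffWithinAt
  have sc : ContDiffOn ℝ ∞ c N₀ :=
    ((sU' _).mul (hF.smooth.mono fun z hz => (hN₀ z hz).2.2)).add ((sU' _).mul (contDiffOn_coord 2))
  have hpd_a : ∀ z ∈ N₀, ∀ i, pd i a z = (Pi.single i 1 : Space) 0 * deriv X (z 0) :=
    fun z hz i => (hasDirDeriv_comp_coord ((hN₀ z hz).1.1.differentiableAt (by simp)) _).2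
  have hpd_b : ∀ z ∈ N₀, ∀ i, pd i b z
      = fderiv ℝ U (z 0, z 1) ((Pi.single i 1 : Space) 0, (Pi.single i 1 : Space) 1) :=
    fun z hz i => (hasDirDeriv_comp_coord_prod ((hN₀ z hz).1.2.differentiableAt (by simp)) _).2
  have hmaps : ContinuousAt (fun z => ![a z, b z, c z]) p := by
    refine continuousAt_pi.2 fun i => ?_
    have hn := hN₀o.mem_nhds hpN₀
    fin_cases i
    exacts [sa.continuousOn.continuousAt hn, sb.continuousOn.continuousAt hn,
      sc.continuousOn.continuousAt hn]
  have hpq' : ![a p, b p, c p] = q := hpq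
  have hn := hN₀o.mem_nhds hpN₀
  -- The conditions known only at `p`, namely landing in `D'` and `X_x, U_u ≠ 0`, persist on a
  -- smaller neighbourhood.
  obtain ⟨N, hN, hNo, hpN⟩ := eventually_nhds_iff.1 ((hN₀o.eventually_mem hpN₀).and
    ((hmaps.eventually_mem (hG.isOpen.mem_nhds (hpq' ▸ hq))).and
      ((((sX'.continuousOn.continuousAt hn).eventually_ne hX0)).and
        ((sU' (0, 1)).continuousOn.continuousAt hn |>.eventually_ne hU0))))
  have hNN : N ⊆ N₀ := fun z hz => (hN z hz).1
  have hprolong : IsProlongation F N G D' a b c :=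
    { smooth_a := sa.mono hNN
      smooth_b := sb.mono hNN
      smooth_c := sc.mono hNN
      pd_one_a := fun z hz => by simp [hpd_a z (hNN hz)]
      pd_two_a := fun z hz => by simp [hpd_a z (hNN hz)]
      pd_two_b := fun z hz => by
        rw [hpd_b z (hNN hz)]
        exact map_zero (fderiv ℝ U (z 0, z 1))
      c_eq := fun z hz => by simp [hpd_b z (hNN hz), hc]
      pd_zero_a_ne_zero := fun z hz => by simpa [hpd_a z (hNN hz)] using (hN z hz).2.2.1
      pd_one_b_ne_zero := fun z hz => by simpa [hpd_b z (hNN hz)] using (hN z hz).2.2.2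
      maps := fun z hz => (hN z hz).2.1
      system := fun z hz => by
        rw [← hprol, ← (hN₀ z (hNN hz)).2.1, hpd_a z (hNN hz)]
        simp }
  rw [← hpq', hprolong.sigma_eq (hF.mono hNo fun z hz => (hN₀ z (hNN hz)).2.2) hG hpN]

/-! ### Construction of feedback transformations -/

/-- `f` is constant along the segment from `w` to `z`. This turns vanishing partial derivatives of a
map on a ball into independence of the corresponding coordinates. -/
theorem eq_of_fderiv_apply_sub_eq_zero {f : Space → ℝ} {B : Set Space} (hB : Convex ℝ B)
    {z w : Space} (hz : z ∈ B) (hw : w ∈ B) (hf : ∀ y ∈ B, HasDirDeriv f y (z - w) 0) :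
    f z = f w := by
  set γ : ℝ → Space := fun t => w + t • (z - w) with hγ
  have hmem : ∀ t ∈ Set.Icc (0 : ℝ) 1, γ t ∈ B := fun t ht => hB.add_smul_sub_mem hw hz ht
  have hγd : ∀ t, HasDerivAt γ (z - w) t := fun t => by
    have h := ((hasDerivAt_id t).smul_const (z - w)).const_add w
    rw [one_smul] at h
    exact h
  have hd : ∀ t ∈ Set.Icc (0 : ℝ) 1, HasDerivAt (fun t => f (γ t)) 0 t := fun t ht => by
    have h := (hf _ (hmem t ht)).1.hasFDerivAt.comp_hasDerivAt t (hγd t)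
    rw [(hf _ (hmem t ht)).2] at h
    exact h
  have key := constant_of_has_deriv_right_zero
    (fun t ht => (hd t ht).continuousAt.continuousWithinAt)
    (fun t ht => (hd t (Set.Ico_subset_Icc_self ht)).hasDerivWithinAt) 1 (by simp)
  simpa [hγ] using key

/-- Two regular systems with the same `Σ` are locally related, at points with the same value of
`σ`, by a map that carries the one frame to the other. -/
theorem exists_map_frame {F G : Space → ℝ} {D D' : Set Space} (hF : IsRegular F D)
    (hG : IsRegular G D') (hS : Sigma F D = Sigma G D') {p q : Space} (hp : p ∈ D) (hq : q ∈ D')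
    (hpq : sigma F p = sigma G q) :
    ∃ (φ : Space → Space) (N : Set Space), IsOpen N ∧ p ∈ N ∧ N ⊆ D ∧ ContDiffOn ℝ ∞ φ N ∧
      φ p = q ∧ (∀ z ∈ N, φ z ∈ D') ∧
      ∀ z ∈ N, ∀ i, fderiv ℝ φ z (frame F i z) = frame G i (φ z) := by
  obtain ⟨a, W, V, g, hpW, hcF⟩ := hF.exists_isChart ⟨p, hp, rfl⟩
  -- As the images coincide, one chart serves both systems.
  have hcG : IsChart (Sigma G D') a W V g := hS ▸ hcF
  have hqW : sigma G q ∈ W := hpq ▸ hpW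
  have jF := hF.hasRegularJets
  have jG := hG.hasRegularJets
  have sF := jF.contDiffOn_coordMap a
  have sG := jG.contDiffOn_coordMap a
  have hAG : ∀ z, (hz : z ∈ D') → (hzW : sigma G z ∈ W) → HasFDerivAt (coordMap G a)
      ((ContinuousLinearMap.toContinuousLinearEquivOfDetNeZero _
        (hG.det_fderiv_coordMap_ne_zero hcG hz hzW) : Space ≃L[ℝ] Space) : Space →L[ℝ] Space) z :=
    fun z hz hzW => by
      rw [ContinuousLinearMap.coe_toContinuousLinearEquivOfDetNeZero]
      exact (differentiableAt_of_contDiffOn hG.isOpen sG hz).hasFDerivAt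
  have cG : ∀ z ∈ D', ContDiffAt ℝ ∞ (coordMap G a) z := fun z hz =>
    sG.contDiffAt (hG.isOpen.mem_nhds hz)
  set e := (cG q hq).toOpenPartialHomeomorph _ (hAG q hq hqW) (by simp)
  have he : ∀ z, e z = coordMap G a z := fun z => rfl
  have hqe : q ∈ e.source := (cG q hq).mem_toOpenPartialHomeomorph_source (hAG q hq hqW) (by simp)
  have hApq : coordMap F a p = e q := by
    rw [he]
    exact funext fun k => congrFun hpq (a k)
  -- `φ` identifies points with equal chart coordinates, inverting `coordMap G` near `q`.
  set φ : Space → Space := fun z => e.symm (coordMap F a z) with hφ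
  have hφp : φ p = q := by
    simp only [hφ, hApq]
    exact e.left_inv hqe
  have cF : ContinuousAt (coordMap F a) p :=
    sF.continuousOn.continuousAt (hF.isOpen.mem_nhds hp)
  have htp : coordMap F a p ∈ e.target := hApq ▸ e.map_source hqe
  have cφ : ContinuousAt φ p := (e.continuousAt_symm htp).comp cF
  have hM := jG.eventually_mem_chart hcG hq hqW
  rw [← hφp] at hM
  obtain ⟨N, hN, hNo, hpN⟩ := eventually_nhds_iff.1
    (((jF.eventually_mem_chart hcF hp hpW).and (cF.eventually_mem (e.open_target.mem_nhds htp))).and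
      (cφ.eventually hM))
  have hAφ : ∀ z ∈ N, coordMap G a (φ z) = coordMap F a z := fun z hz =>
    e.right_inv (hN z hz).1.2
  -- Both points of `Σ` lie in the chart and are recovered by `g` from the same three coordinates,
  -- so all fourteen components agree.
  have hσ : ∀ z ∈ N, sigma G (φ z) = sigma F z := fun z hz => by
    have h1 := (hcF.apply_eq ⟨z, (hN z hz).1.1.1, rfl⟩ (hN z hz).1.1.2).2
    have h2 := (hcG.apply_eq ⟨φ z, (hN z hz).2.1, rfl⟩ (hN z hz).2.2).2
    rw [← h1, ← h2]
    exact congrArg g (hAφ z hz)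
  have sφ : ContDiffOn ℝ ∞ φ N := fun z hz =>
    ((e.contDiffAt_symm (hN z hz).1.2 (hAG _ (hN z hz).2.1 (hN z hz).2.2)
      (cG _ (hN z hz).2.1)).comp z
      (sF.contDiffAt (hF.isOpen.mem_nhds (hN z hz).1.1.1))).contDiffWithinAt
  refine ⟨φ, N, hNo, hpN, fun z hz => (hN z hz).1.1.1, sφ, hφp, fun z hz => (hN z hz).2.1, ?_⟩
  intro z hz i
  have hDz := (hN z hz).1.1.1
  have hDφ := (hN z hz).2.1
  have hdet := hG.det_fderiv_coordMap_ne_zero hcG hDφ (hN z hz).2.2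
  -- After the injective derivative of `coordMap G` is applied, both sides are rows of
  -- `frameJacobian`, which depends on `σ` alone.
  refine (ContinuousLinearMap.toContinuousLinearEquivOfDetNeZero _ hdet).injective ?_
  simp only [ContinuousLinearMap.toContinuousLinearEquivOfDetNeZero_apply]
  have hchain : fderiv ℝ (coordMap F a) z
      = (fderiv ℝ (coordMap G a) (φ z)).comp (fderiv ℝ φ z) := by
    rw [← fderiv_comp z (differentiableAt_of_contDiffOn hG.isOpen sG hDφ)
      (differentiableAt_of_contDiffOn hNo sφ hz)]
    exact (Filter.eventuallyEq_of_mem (hNo.mem_nhds hz) hAφ).symm.fderiv_eq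
  have h1 : fderiv ℝ (coordMap F a) z (frame F i z)
      = fderiv ℝ (coordMap G a) (φ z) (fderiv ℝ φ z (frame F i z)) := by rw [hchain]; rfl
  rw [← h1]
  ext k
  rw [jF.fderiv_coordMap_frame hDz hcF.index_mem, jG.fderiv_coordMap_frame hDφ hcG.index_mem,
    frameJacobian, frameJacobian, hσ z hz]

/-- A map carrying frame to frame preserves the flag spanned by `∇₂` and by `∇₁, ∇₂`, so its first
two components are `X(x)` and `U(x, u)`. The remaining components of the frame equations say that it
is the prolongation of `(X, U)` and relates `F` to `G`. -/
theorem feedbackEquivalentAt_of_sigma_eq {F G : Space → ℝ} {D D' : Set Space} (hF : IsRegular F D)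
    (hG : IsRegular G D') (hS : Sigma F D = Sigma G D') {p q : Space} (hp : p ∈ D) (hq : q ∈ D')
    (hpq : sigma F p = sigma G q) : FeedbackEquivalentAt F p G q := by
  obtain ⟨φ, N, hNo, hpN, hND, sφ, hφp, hmaps, hframe⟩ := exists_map_frame hF hG hS hp hq hpq
  have sk : ∀ k, ContDiffOn ℝ ∞ (fun z => φ z k) N := contDiffOn_pi.1 sφ
  have dk : ∀ k, ∀ z ∈ N, DifferentiableAt ℝ (fun z => φ z k) z := fun k z hz =>
    differentiableAt_of_contDiffOn hNo (sk k) hz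
  have hfr : ∀ z ∈ N, ∀ i k, frame F i z 0 * pd 0 (fun z => φ z k) z
      + frame F i z 1 * pd 1 (fun z => φ z k) z + frame F i z 2 * pd 2 (fun z => φ z k) z
      = frame G i (φ z) k := fun z hz i k => by
    rw [← fderiv_apply_eq_pd, ← hframe z hz i,
      fderiv_apply (differentiableAt_of_contDiffOn hNo sφ hz) k]
    rfl
  have n20 : ∀ z ∈ N, F z / pd 2 F z ≠ 0 := fun z hz =>
    div_ne_zero (hF.ne_zero z (hND hz)) (hF.d_ne_zero z (hND hz))
  have n11 : ∀ z ∈ N, (z 2 * pd 2 F z - F z) / pd 2 F z ≠ 0 := fun z hz =>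
    div_ne_zero (hF.denom_ne_zero z (hND hz)) (hF.d_ne_zero z (hND hz))
  have vertical : ∀ z ∈ N, ∀ k, frame G 1 (φ z) k = 0 → pd 2 (fun z => φ z k) z = 0 :=
    fun z hz k hk => by
      have h : 0 * _ + 0 * _ + F z / pd 2 F z * pd 2 (fun z => φ z k) z = frame G 1 (φ z) k :=
        hfr z hz 1 k
      rw [hk, zero_mul, zero_mul, add_zero, zero_add] at h
      exact (mul_eq_zero.1 h).resolve_left (n20 z hz)
  have h02 : ∀ z ∈ N, pd 2 (fun z => φ z 0) z = 0 := fun z hz => vertical z hz 0 rfl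
  have h12 : ∀ z ∈ N, pd 2 (fun z => φ z 1) z = 0 := fun z hz => vertical z hz 1 rfl
  have h01 : ∀ z ∈ N, pd 1 (fun z => φ z 0) z = 0 := fun z hz => by
    have h : 0 * _ + (z 2 * pd 2 F z - F z) / pd 2 F z * pd 1 (fun z => φ z 0) z
      + frame F 0 z 2 * pd 2 (fun z => φ z 0) z = 0 := hfr z hz 0 0
    rw [h02 z hz, zero_mul, mul_zero, add_zero, zero_add] at h
    exact (mul_eq_zero.1 h).resolve_left (n11 z hz)
  have h11 : ∀ z ∈ N, (z 2 * pd 2 F z - F z) / pd 2 F z * pd 1 (fun z => φ z 1) z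
      = (φ z 2 * pd 2 G (φ z) - G (φ z)) / pd 2 G (φ z) := fun z hz => by
    have h : 0 * _ + (z 2 * pd 2 F z - F z) / pd 2 F z * pd 1 (fun z => φ z 1) z
      + frame F 0 z 2 * pd 2 (fun z => φ z 1) z
      = (φ z 2 * pd 2 G (φ z) - G (φ z)) / pd 2 G (φ z) := hfr z hz 0 1
    rw [h12 z hz] at h
    linarith
  have h00 : ∀ z ∈ N, F z * pd 0 (fun z => φ z 0) z = G (φ z) := fun z hz => by
    have h : F z * pd 0 (fun z => φ z 0) z + F z / pd 2 F z * pd 1 (fun z => φ z 0) z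
      + frame F 2 z 2 * pd 2 (fun z => φ z 0) z = G (φ z) := hfr z hz 2 0
    rw [h01 z hz, h02 z hz] at h
    linarith
  -- The sum of the `u`-components of the equations for `∇₁` and `∇₃`: the terms `F / F_{u₁}` cancel
  -- on both sides.
  have h2 : ∀ z ∈ N, pd 0 (fun z => φ z 1) z * F z + pd 1 (fun z => φ z 1) z * z 2 = φ z 2 :=
    fun z hz => by
      have h : F z * pd 0 (fun z => φ z 1) z + F z / pd 2 F z * pd 1 (fun z => φ z 1) z
        + frame F 2 z 2 * pd 2 (fun z => φ z 1) z = G (φ z) / pd 2 G (φ z) := hfr z hz 2 1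
      have h' := h11 z hz
      rw [h12 z hz] at h
      rw [sub_div, mul_div_cancel_right₀ _ (hF.d_ne_zero z (hND hz)), sub_div,
        mul_div_cancel_right₀ _ (hG.d_ne_zero _ (hmaps z hz))] at h'
      linarith
  obtain ⟨r, hr, hball⟩ := Metric.isOpen_iff.1 hNo p hpN
  have hmem : ∀ z : Space, z ∈ Metric.ball p r ↔ ∀ i, dist (z i) (p i) < r := fun z => by
    rw [Metric.mem_ball, dist_pi_lt_iff hr]
  -- `X` and `U` are the components of `φ` with the irrelevant coordinates frozen at those of `p`;
  -- convexity of the ball makes the choice immaterial.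
  set ι₁ : ℝ → Space := fun x => ![x, p 1, p 2] with hι₁
  set ι₂ : ℝ × ℝ → Space := fun y => ![y.1, y.2, p 2] with hι₂
  have sι₁ : ContDiff ℝ ∞ ι₁ := contDiff_pi.2 fun i => by
    fin_cases i
    exacts [contDiff_id, contDiff_const, contDiff_const]
  have sι₂ : ContDiff ℝ ∞ ι₂ := contDiff_pi.2 fun i => by
    fin_cases i
    exacts [contDiff_fst, contDiff_snd, contDiff_const]
  have mι₁ : ∀ x, dist x (p 0) < r → ι₁ x ∈ Metric.ball p r := fun x hx => by
    rw [hmem]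
    intro i
    fin_cases i
    · exact hx
    · simpa [hι₁] using hr
    · simpa [hι₁] using hr
  have mι₂ : ∀ y : ℝ × ℝ, dist y (p 0, p 1) < r → ι₂ y ∈ Metric.ball p r := fun y hy => by
    rw [Prod.dist_eq, max_lt_iff] at hy
    rw [hmem]
    intro i
    fin_cases i
    · exact hy.1
    · exact hy.2
    · simpa [hι₂] using hr
  set X : ℝ → ℝ := fun x => φ (ι₁ x) 0
  set U : ℝ × ℝ → ℝ := fun y => φ (ι₂ y) 1
  have sX : ∀ x, dist x (p 0) < r → ContDiffAt ℝ ∞ X x := fun x hx =>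
    ((sk 0).contDiffAt (hNo.mem_nhds (hball (mι₁ x hx)))).comp x sι₁.contDiffAt
  have sU : ∀ y : ℝ × ℝ, dist y (p 0, p 1) < r → ContDiffAt ℝ ∞ U y := fun y hy =>
    ((sk 1).contDiffAt (hNo.mem_nhds (hball (mι₂ y hy)))).comp y sι₂.contDiffAt
  have dz1 : ∀ z ∈ Metric.ball p r, dist (z 0) (p 0) < r := fun z hz => (hmem z).1 hz 0
  have dz2 : ∀ z ∈ Metric.ball p r, dist (z 0, z 1) (p 0, p 1) < r := fun z hz => by
    rw [Prod.dist_eq]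
    exact max_lt ((hmem z).1 hz 0) ((hmem z).1 hz 1)
  have eX : ∀ z ∈ Metric.ball p r, φ z 0 = X (z 0) := fun z hz =>
    eq_of_fderiv_apply_sub_eq_zero (f := fun z => φ z 0) (convex_ball p r) hz (mι₁ _ (dz1 z hz))
      fun y hy => ⟨dk 0 y (hball hy), by
        rw [fderiv_apply_eq_pd, h01 y (hball hy), h02 y (hball hy)]
        simp [hι₁]⟩
  have eU : ∀ z ∈ Metric.ball p r, φ z 1 = U (z 0, z 1) := fun z hz =>
    eq_of_fderiv_apply_sub_eq_zero (f := fun z => φ z 1) (convex_ball p r) hz (mι₂ _ (dz2 z hz))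
      fun y hy => ⟨dk 1 y (hball hy), by
        rw [fderiv_apply_eq_pd, h12 y (hball hy)]
        simp [hι₂]⟩
  have dX : ∀ z ∈ Metric.ball p r, pd 0 (fun z => φ z 0) z = deriv X (z 0) := fun z hz => by
    rw [pd, fderiv_eq_of_eqOn Metric.isOpen_ball eX hz,
      (hasDirDeriv_comp_coord ((sX _ (dz1 z hz)).differentiableAt (by simp)) _).2]
    simp
  have dU : ∀ z ∈ Metric.ball p r, ∀ i, pd i (fun z => φ z 1) z
      = fderiv ℝ U (z 0, z 1) ((Pi.single i 1 : Space) 0, (Pi.single i 1 : Space) 1) :=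
    fun z hz i => by
      rw [pd, fderiv_eq_of_eqOn Metric.isOpen_ball eU hz]
      exact (hasDirDeriv_comp_coord_prod ((sU _ (dz2 z hz)).differentiableAt (by simp)) _).2
  have dU0 : ∀ z ∈ Metric.ball p r, pd 0 (fun z => φ z 1) z = fderiv ℝ U (z 0, z 1) (1, 0) :=
    fun z hz => dU z hz 0
  have dU1 : ∀ z ∈ Metric.ball p r, pd 1 (fun z => φ z 1) z = fderiv ℝ U (z 0, z 1) (0, 1) :=
    fun z hz => dU z hz 1
  have hprol : ∀ z ∈ Metric.ball p r, prolong F X U z = φ z := fun z hz => by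
    ext k
    fin_cases k
    · exact (eX z hz).symm
    · exact (eU z hz).symm
    · change fderiv ℝ U (z 0, z 1) (1, 0) * F z + fderiv ℝ U (z 0, z 1) (0, 1) * z 2 = φ z 2
      rw [← dU0 z hz, ← dU1 z hz, h2 z (hball hz)]
  have hpB : p ∈ Metric.ball p r := Metric.mem_ball_self hr
  refine ⟨X, U, Filter.eventually_of_mem (Metric.ball_mem_nhds _ hr) sX,
    Filter.eventually_of_mem (Metric.ball_mem_nhds _ hr) sU, ?_, ?_, (hprol p hpB).trans hφp,
    Filter.eventually_of_mem (Metric.ball_mem_nhds _ hr) fun z hz => ?_⟩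
  · rw [← dX p hpB]
    exact right_ne_zero_of_mul ((h00 p hpN).trans_ne (hG.ne_zero _ (hmaps p hpN)))
  · rw [← dU1 p hpB]
    exact right_ne_zero_of_mul ((h11 p hpN).trans_ne (div_ne_zero
      (hG.denom_ne_zero _ (hmaps p hpN)) (hG.d_ne_zero _ (hmaps p hpN))))
  · rw [hprol z hz, ← dX z hz, ← h00 z (hball hz), mul_comm]

end FeedbackControl

end

/-! ### The equivalence theorem -/

theorem theorem3 (F G : FeedbackControl.Space → ℝ) (D D' : Set FeedbackControl.Space)
    (hF : FeedbackControl.IsRegular F D) (hG : FeedbackControl.IsRegular G D') :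
    FeedbackControl.LocallyFeedbackEquivalent F D G D' ↔
      FeedbackControl.Sigma F D = FeedbackControl.Sigma G D' := by
  open FeedbackControl in
  constructor
  · rintro ⟨h1, h2⟩
    refine Set.Subset.antisymm ?_ ?_
    · rintro _ ⟨p, hp, rfl⟩
      obtain ⟨q, hq, h⟩ := h1 p hp
      exact ⟨q, hq, (h.sigma_eq hF.hasRegularJets hG.hasRegularJets hp hq).symm⟩
    · rintro _ ⟨q, hq, rfl⟩
      obtain ⟨p, hp, h⟩ := h2 q hq
      exact ⟨p, hp, h.sigma_eq hF.hasRegularJets hG.hasRegularJets hp hq⟩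
  · intro hS
    refine ⟨fun p hp => ?_, fun q hq => ?_⟩
    · obtain ⟨q, hq, h⟩ : sigma F p ∈ Sigma G D' := hS ▸ Set.mem_image_of_mem _ hp
      exact ⟨q, hq, feedbackEquivalentAt_of_sigma_eq hF hG hS hp hq h.symm⟩
    · obtain ⟨p, hp, h⟩ : sigma G q ∈ Sigma F D := hS ▸ Set.mem_image_of_mem _ hq
      exact ⟨p, hp, feedbackEquivalentAt_of_sigma_eq hF hG hS hp hq h⟩
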